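/- **Setting.** Let $\Delta$ be a connected simply-laced Dynkin diagram (type $A_n$ with $n\ge 1$, $D_n$ with $n\ge 4$, or $E_{6,7,8}$) with vertex set $\Delta_0$, and let $\sigma$ be an automorphism of $\Delta$ such that no vertex $\imath$ is adjacent to $\sigma(\imath)$. Let $r$ be the order of $\sigma$, let $I$ be the set of $\sigma$-orbits in $\Delta_0$, and write $\bar\imath$ for the orbit of $\imath$. For $i,j\in I$ put $d_i:=|i|$, write $i\sim j$ if some vertex of $i$ is adjacent to some vertex of $j$, and put $c_{ii}:=2$, $c_{ij}:=-\lceil d_j/d_i\rceil$ if $i\ne j$ and $i\sim j$, and $c_{ij}:=0$ otherwise; $(c_{ij})$ is the Cartan matrix of a simple Lie algebra $\mathfrak g$. Let $\mathsf P=\bigoplus_{\imath\in\Delta_0}\mathbb Z\varpi_\imath$, $\alpha_\imath=2\varpi_\imath-\sum_{\jmath\sim\imath}\varpi_\jmath$, let $(\ ,\ )$ be the bilinear pairing with $(\varpi_\imath,\alpha_\jmath)=\delta_{\imath\jmath}$, let $s_\imath(\lambda)=\lambda-(\lambda,\alpha_\imath)\alpha_\imath$, and let $\sigma$ act on $\mathsf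 P$ by $\sigma(\varpi_\imath)=\varpi_{\sigma(\imath)}$. A *Q-datum* for $\mathfrak g$ is a triple $\mathcal Q=(\Delta,\sigma,\xi)$ where $\xi:\Delta_0\to\mathbb Z$ satisfies: * (H1) if $\imath\sim\jmath$ and $d_{\bar\imath}=d_{\bar\jmath}$, then $|\xi_\imath-\xi_\jmath|=d_{\bar\imath}$; * (H2) if $i\sim j$ in $I$, $d_i<d_j$ and $i=\{\imath\}$, there is a unique $j^\circ\in j$ such that $|\xi_\imath-\xi_{j^\circ}|=1$ and $\xi_{\sigma^k(j^\circ)}=\xi_{j^\circ}-2k$ for $0\le k<r$. Consider the quiver with vertices the pairs $(\imath,p)\in\Delta_0\times\mathbb Z$ with $p-\xi_\imath\in 2d_{\bar\imath}\mathbb Z$ and an arrow $(\imath,p)\to(\jmath,s)$ whenever $\imath\sim\jmath$ and $s-p=\min(d_{\bar\imath},d_{\bar\jmath})$. A compatible reading of a finite set $X$ of vertices is an enumeration $(\imath_1,p_1),\dots,(\imath_m,p_m)$ of $X$ in which the target of each arrow comes before its source, and $w[X]:=s_{\imath_1}\cdots s_{\imath_m}$ for a compatible reading of $X$ (for the two sets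 used here it does not depend on the reading). Let $I^\circ_{\mathcal Q}\subset\Delta_0$ be the set of vertices at which $\xi$ is maximal on their $\sigma$-orbit, and set $$X^\circ:=\{(\imath,\xi_\imath)\mid \imath\in I^\circ_{\mathcal Q}\},\qquad X':=\{(\sigma(\imath),p)\mid \imath\in I^\circ_{\mathcal Q},\ \xi_{\sigma(\imath)}<p\le\xi_\imath-2,\ p-\xi_{\sigma(\imath)}\in 2d_{\bar\imath}\mathbb Z\},$$ $$\tau_{\mathcal Q}:=w[X']^{-1}\,w[X^\circ]\,\sigma\,w[X'],\qquad \gamma_\imath:=(1-\tau_{\mathcal Q}^{d_{\bar\imath}})\varpi_\imath .$$ **Theorem ($\mathfrak g$-additive property).** Let $\mathcal Q=(\Delta,\sigma,\xi)$ be a Q-datum for $\mathfrak g$ and let $I^\circ\subset\Delta_0$ be an arbitrary section of the quotient map $\Delta_0\to I$. Let $\imath\in\Delta_0$ and $l\in\mathbb Z$. Then $\xi_\jmath-\xi_\imath+\min(d_{\bar\imath},d_{\bar\jmath})$ is even for every $\jmath\in\Delta_0$ with $\bar\jmath\sim\bar\imath$, and $$\tau_{\mathcal Q}^{l}(\gamma_\imath)+\tau_{\mathcal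 Q}^{l+d_{\bar\imath}}(\gamma_\imath) =\sum_{\jmath\in I^\circ,\ \bar\jmath\sim\bar\imath}\ \sum_{t=0}^{-c_{\bar\jmath\bar\imath}-1}\tau_{\mathcal Q}^{\,l+t+(\xi_\jmath-\xi_\imath+\min(d_{\bar\imath},d_{\bar\jmath}))/2}(\gamma_\jmath)$$ in $\mathsf P$, and, in $\mathbb Q\otimes\mathsf P$, the same element equals $$\sum_{j\in I,\ j\sim\bar\imath}\ \sum_{t=0}^{-c_{j\bar\imath}-1}\frac1{d_j}\sum_{\jmath\in j}\tau_{\mathcal Q}^{\,l+t+(\xi_\jmath-\xi_\imath+\min(d_{\bar\imath},d_j))/2}(\gamma_\jmath).$$ -/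

import Mathlib

open scoped Classical

/-- The simply-laced Cartan matrix `2 - (adjacency matrix)` of a graph. -/
noncomputable def graphCartanMatrix {V : Type*} (Δ : SimpleGraph V) : Matrix V V ℤ :=
  Matrix.of fun i j => if i = j then 2 else if Δ.Adj i j then -1 else 0

/-- `Δ` is a (connected) Dynkin diagram of type `A_n` (`n ≥ 1`), `D_n` (`n ≥ 4`) or
`E_6`, `E_7`, `E_8`. -/
def IsDynkinADE {V : Type*} (Δ : SimpleGraph V) : Prop :=
  (∃ n : ℕ, 1 ≤ n ∧ ∃ e : V ≃ Fin n,
    (graphCartanMatrix Δ).reindex e e = CartanMatrix.A n) ∨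
  (∃ n : ℕ, 4 ≤ n ∧ ∃ e : V ≃ Fin n,
    (graphCartanMatrix Δ).reindex e e = CartanMatrix.D n) ∨
  (∃ e : V ≃ Fin 6, (graphCartanMatrix Δ).reindex e e = CartanMatrix.E₆) ∨
  (∃ e : V ≃ Fin 7, (graphCartanMatrix Δ).reindex e e = CartanMatrix.E₇) ∨
  (∃ e : V ≃ Fin 8, (graphCartanMatrix Δ).reindex e e = CartanMatrix.E₈)

/-! ### The weight lattice of the simply-laced Lie algebra and the simple reflections -/

/-- The weight lattice `P = ⨁ ℤ ϖ_i`; the value `x i` is the coefficient of `ϖ_i`, that is,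
the pairing `(x, α_i)`. -/
abbrev WeightLattice (V : Type*) := V → ℤ

/-- The fundamental weight `ϖ_i`. -/
noncomputable def fundWeight {V : Type*} (i : V) : WeightLattice V := Pi.single i 1

/-- The simple root `α_i = 2 ϖ_i - ∑_{j ∼ i} ϖ_j`. -/
noncomputable def simpleRoot {V : Type*} [Fintype V] (Δ : SimpleGraph V) (i : V) :
    WeightLattice V :=
  2 • fundWeight i - ∑ j : V with Δ.Adj i j, fundWeight j

theorem simpleRoot_apply_self {V : Type*} [Fintype V] (Δ : SimpleGraph V) (i : V) :
    (LinearMap.proj i : WeightLattice V →ₗ[ℤ] ℤ) (simpleRoot Δ i) = 2 := by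
  have h : ∑ j : V with Δ.Adj i j, (fundWeight j : WeightLattice V) i = 0 := by
    refine Finset.sum_eq_zero fun j hj => ?_
    have hij : i ≠ j := (Finset.mem_filter.1 hj).2.ne
    simp [fundWeight, hij]
  simp [simpleRoot, Finset.sum_apply, h]
  simp [fundWeight]

/-- The simple reflection `s_i : x ↦ x - (x, α_i) α_i` of the weight lattice. -/
noncomputable def simpleReflection {V : Type*} [Fintype V] (Δ : SimpleGraph V) (i : V) :
    WeightLattice V ≃ₗ[ℤ] WeightLattice V :=
  Module.reflection (simpleRoot_apply_self Δ i)

/-- The inclusion of `P` into `ℚ ⊗ P`. -/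
def weightToRat {V : Type*} (x : WeightLattice V) : V → ℚ := fun i => (x i : ℚ)

/-! ### Diagram automorphisms -/

/-- A Dynkin diagram `Δ` of type `ADE` together with an automorphism `σ` such that no vertex
is adjacent to its image under `σ`. -/
structure DiagramPair (V : Type*) [Fintype V] where
  Δ : SimpleGraph V
  ade : IsDynkinADE Δ
  σ : Δ ≃g Δ
  not_adj : ∀ i : V, ¬ Δ.Adj i (σ i)

namespace DiagramPair

/-- `σ` as a permutation of the vertices. -/
def perm {V : Type*} [Fintype V] (D : DiagramPair V) : Equiv.Perm V := D.σ.toEquiv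

/-- The order `r` of `σ`. -/
noncomputable def r {V : Type*} [Fintype V] (D : DiagramPair V) : ℕ := orderOf D.perm

/-- The set `I` of `σ`-orbits of vertices. -/
abbrev I {V : Type*} [Fintype V] (D : DiagramPair V) : Type _ :=
  Quotient (Equiv.Perm.SameCycle.setoid D.perm)

/-- The natural quotient map from vertices to orbits. -/
def orb {V : Type*} [Fintype V] (D : DiagramPair V) (i : V) : D.I :=
  Quotient.mk (Equiv.Perm.SameCycle.setoid D.perm) i

/-- The vertices in an orbit. -/
noncomputable def fiber {V : Type*} [Fintype V] (D : DiagramPair V) (j : D.I) : Finset V :=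
  {v : V | D.orb v = j}

/-- `d_j` is the size of the orbit `j`. -/
noncomputable def d {V : Type*} [Fintype V] (D : DiagramPair V) (j : D.I) : ℕ :=
  (D.fiber j).card

/-- Adjacency of orbits: some vertex of one is adjacent to some vertex of the other. -/
def orbAdj {V : Type*} [Fintype V] (D : DiagramPair V) (i j : D.I) : Prop :=
  ∃ v w : V, D.orb v = i ∧ D.orb w = j ∧ D.Δ.Adj v w

/-- The Cartan matrix `(c_{ij})` of the folded Lie algebra. -/
noncomputable def c {V : Type*} [Fintype V] (D : DiagramPair V) (i j : D.I) : ℤ :=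
  if i = j then 2 else if D.orbAdj i j then -⌈(D.d j : ℚ) / (D.d i : ℚ)⌉ else 0

/-- The action of `σ` on the weight lattice, `σ (ϖ_i) = ϖ_{σ i}`. -/
def sigmaAct {V : Type*} [Fintype V] (D : DiagramPair V) :
    WeightLattice V ≃ₗ[ℤ] WeightLattice V :=
  LinearEquiv.funCongrLeft ℤ ℤ D.perm.symm

theorem sigmaAct_fundWeight {V : Type*} [Fintype V] (D : DiagramPair V) (i : V) :
    D.sigmaAct (fundWeight i) = fundWeight (D.σ i) := by
  ext v
  have h : D.perm.symm v = i ↔ v = D.σ i := Equiv.symm_apply_eq D.perm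
  simp [sigmaAct, fundWeight, LinearEquiv.funCongrLeft, LinearMap.funLeft, Pi.single_apply, h]

/-- Height functions on `(Δ, σ)`. -/
structure IsHeightFunction {V : Type*} [Fintype V] (D : DiagramPair V) (ξ : V → ℤ) : Prop where
  height_of_eq : ∀ i j : V, D.Δ.Adj i j → D.d (D.orb i) = D.d (D.orb j) →
    |ξ i - ξ j| = D.d (D.orb i)
  height_of_lt : ∀ i j : D.I, D.orbAdj i j → D.d i < D.d j → ∀ v : V, D.orb v = i →
    ∃! w : V, D.orb w = j ∧ |ξ v - ξ w| = 1 ∧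
      ∀ k : ℕ, k < D.r → ξ ((D.perm ^ k) w) = ξ w - 2 * k

end DiagramPair

/-- A Q-datum `(Δ, σ, ξ)`. -/
structure QDatum (V : Type*) [Fintype V] extends DiagramPair V where
  ξ : V → ℤ
  isHeight : toDiagramPair.IsHeightFunction ξ

namespace QDatum

/-- The vertices of the repetition quiver: pairs `(i, p)` with `p ≡ ε_i` modulo `2 d_i`, where the
parity function `ε` is given by the residues of the height function, `ε_i ≡ ξ_i` modulo `2 d_i`. -/
def IsRepVertex {V : Type*} [Fintype V] (Q : QDatum V) (x : V × ℤ) : Prop :=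
  2 * (Q.d (Q.orb x.1) : ℤ) ∣ x.2 - Q.ξ x.1

/-- The arrows `(i, p) → (j, s)` of the repetition quiver: `i ∼ j` and `s - p = min(d_i, d_j)`. -/
def RepArrow {V : Type*} [Fintype V] (Q : QDatum V) (x y : V × ℤ) : Prop :=
  Q.IsRepVertex x ∧ Q.IsRepVertex y ∧ Q.Δ.Adj x.1 y.1 ∧
    y.2 - x.2 = min (Q.d (Q.orb x.1) : ℤ) (Q.d (Q.orb y.1))

/-- `L` is a compatible reading of the finite set `X`: an enumeration of `X` without repetition in
which the target of an arrow always comes before its source. -/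
def IsCompatibleReading {V : Type*} [Fintype V] (Q : QDatum V) (X : Finset (V × ℤ))
    (L : List (V × ℤ)) : Prop :=
  L.Nodup ∧ (∀ x, x ∈ L ↔ x ∈ X) ∧ L.Pairwise fun x y => ¬ Q.RepArrow x y

theorem exists_isCompatibleReading {V : Type*} [Fintype V] (Q : QDatum V)
    (X : Finset (V × ℤ)) : ∃ L, Q.IsCompatibleReading X L := by
  induction X using Finset.strongInduction with
  | H X ih =>
    rcases X.eq_empty_or_nonempty with rfl | hX
    · exact ⟨[], by simp [IsCompatibleReading]⟩
    · obtain ⟨x, hx, hmax⟩ := X.exists_max_image (fun y => y.2) hX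
      obtain ⟨L, h1, h2, h3⟩ := ih (X.erase x) (Finset.erase_ssubset hx)
      refine ⟨x :: L, ?_, ?_, ?_⟩
      · rw [List.nodup_cons]
        exact ⟨fun h => by simpa using (h2 x).1 h, h1⟩
      · intro y
        rw [List.mem_cons, h2 y, Finset.mem_erase]
        by_cases hy : y = x
        · simp [hy, hx]
        · simp [hy]
      · rw [List.pairwise_cons]
        refine ⟨fun y hy hxy => ?_, h3⟩
        have hle := hmax y (Finset.mem_of_mem_erase ((h2 y).1 hy))
        have hd : ∀ j : Q.I, 0 < Q.d j := by
          intro j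
          obtain ⟨v, rfl⟩ := Quotient.exists_rep j
          exact Finset.card_pos.2 ⟨v, Finset.mem_filter.2 ⟨Finset.mem_univ v, rfl⟩⟩
        have h4 := hxy.2.2.2
        have h5 := hd (Q.orb x.1)
        have h6 := hd (Q.orb y.1)
        omega

/-- A compatible reading of `X`. -/
noncomputable def reading {V : Type*} [Fintype V] (Q : QDatum V) (X : Finset (V × ℤ)) :
    List (V × ℤ) :=
  (Q.exists_isCompatibleReading X).choose

/-- `w[X] = s_{i_1} ⋯ s_{i_l}` for a compatible reading `((i_1, p_1), …, (i_l, p_l))` of `X`. -/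
noncomputable def w {V : Type*} [Fintype V] (Q : QDatum V) (X : Finset (V × ℤ)) :
    WeightLattice V ≃ₗ[ℤ] WeightLattice V :=
  ((Q.reading X).map fun x => simpleReflection Q.Δ x.1).prod

/-- The set `I°` of the vertices at which `ξ` is maximal on their `σ`-orbit. -/
noncomputable def tops {V : Type*} [Fintype V] (Q : QDatum V) : Finset V :=
  {i : V | ∀ j : V, Q.orb j = Q.orb i → Q.ξ j ≤ Q.ξ i}

/-- `X° = {(i, ξ_i) | i ∈ I°}`. -/
noncomputable def XTop {V : Type*} [Fintype V] (Q : QDatum V) : Finset (V × ℤ) :=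
  Q.tops.image fun i => (i, Q.ξ i)

/-- `X'` is the set of the vertices `(σ i, p)` of the repetition quiver with `i ∈ I°` and
`ξ_{σ i} < p ≤ ξ_i - 2`. -/
noncomputable def XPrime {V : Type*} [Fintype V] (Q : QDatum V) : Finset (V × ℤ) :=
  Q.tops.biUnion fun i =>
    ((Finset.Ioc (Q.ξ (Q.σ i)) (Q.ξ i - 2)).image fun p => (Q.σ i, p)).filter Q.IsRepVertex

/-- The `σ`-Coxeter element `τ° = w[X°] σ`. -/
noncomputable def tauTop {V : Type*} [Fintype V] (Q : QDatum V) :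
    WeightLattice V ≃ₗ[ℤ] WeightLattice V :=
  Q.w Q.XTop * Q.sigmaAct

/-- The generalized `σ`-Coxeter element `τ_Q = w[X']⁻¹ τ° w[X']`. -/
noncomputable def tau {V : Type*} [Fintype V] (Q : QDatum V) :
    WeightLattice V ≃ₗ[ℤ] WeightLattice V :=
  (Q.w Q.XPrime)⁻¹ * Q.tauTop * Q.w Q.XPrime

/-- `γ_i = (1 - τ_Q ^ d_i) ϖ_i`. -/
noncomputable def gamma {V : Type*} [Fintype V] (Q : QDatum V) (i : V) : WeightLattice V :=
  fundWeight i - (Q.tau ^ Q.d (Q.orb i)) (fundWeight i)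

/-- The even integer `ξ_j - ξ_i + min(d_i, d_j)` for adjacent orbits of `i` and `j`. -/
noncomputable def shift {V : Type*} [Fintype V] (Q : QDatum V) (i j : V) : ℤ :=
  Q.ξ j - Q.ξ i + min (Q.d (Q.orb i) : ℤ) (Q.d (Q.orb j))

end QDatum

/-!
The additive property holds because the weights `γ_j` are differences within a system of weights
that satisfies mesh relations on the folded repetition quiver, of the kind known for the translates
of the fundamental weights under a Coxeter element.

For an orbit `J` and an integer `p` with the parity of `ξ` on `J`, let `Ψ J p` be the weight
`τ^((ξ_j - p) / 2) ϖ_j`, where `j ∈ J`. Two facts are needed: the weight does not depend on the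
choice of `j ∈ J`, and the mesh relations
`Ψ I p + Ψ I (p - 2 d_I) = ∑_{K ∼ I} ∑_{0 ≤ t < -c_{IK}} Ψ K (p - min (d_I, d_K) - 2 t)` hold
(`IsMeshSystem`, with `IsNormalizedAt` for `Ψ J (ξ_j) = ϖ_j`). Since `γ_j` is the difference of
`Ψ J (ξ_j)` and `Ψ J (ξ_j - 2 d_J)`, subtracting the mesh relations at `p` and at `p - 2 d_I` gives
the additive property: the sums telescope, which exchanges the multiplicities `-c_{IK}` and
`-c_{KI}` (`sum_range_sub_eq`, `additive_property_orbits`). Its terms depend only on the orbits, so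
any section may be used, and so may the average over each orbit.

The mesh system is constructed in two steps. First, let `η` be the smallest function above `ξ` with
`η (σ v) ≥ ξ v - 2` (`raised`). From the top of an orbit, each application of `σ` before the return
to the top lowers `η` by `2`, and `τ° = w[X°] σ` acts there as `σ` on fundamental weights, because
`w[X°]` contains one simple reflection per orbit, the one at the top. The mesh relation at a top is
then the formula for `w[X°] ϖ_v` in terms of the neighbours of `v` (`w_XTop_of_mem`,
`topSystem_isMeshSystem`). Second, `X'` is the part of the repetition quiver between `ξ` and `η`.
When it is read from above, each of its vertices is a source of the current function at the moment
it is reached, and there the mesh relation computes the next value of the system as `s_v ϖ_v`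
(`IsMeshSystem.apply_sub_of_source`). Hence lowering the function at `v` amounts to the change of
coordinates by `s_v`, and the whole of `X'` to conjugation by `w[X']⁻¹`
(`IsMeshSystem.exists_of_reading`), which turns `τ°` into `τ`.

Of the classification only three consequences enter (`HasDynkinShape`). Together with the conditions
on `ξ` they imply that every orbit is a fixed vertex or has `r ∈ {2, 3}` elements, that
`ξ (σ v) ≡ ξ v - 2` modulo `2 d` (`two_d_dvd`), and that for `r = 3` every vertex that is not fixed
is adjacent to a fixed one (`exists_fixed_adj_of_two_lt`).
-/

/-! ### Graph-theoretic properties of the Dynkin diagrams of type `ADE` -/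

/-- The three properties of a simply-laced Dynkin diagram on which the argument relies: it is
connected, a branch vertex has exactly three neighbours, one of which is a leaf, and an
automorphism that moves no vertex to a neighbour has a fixed vertex. -/
structure HasDynkinShape {V : Type*} (G : SimpleGraph V) : Prop where
  preconnected : G.Preconnected
  branch : ∀ u a b c : V, G.Adj u a → G.Adj u b → G.Adj u c → a ≠ b → a ≠ c → b ≠ c →
    (∀ x, G.Adj u x → x = a ∨ x = b ∨ x = c) ∧ ∃ x, G.Adj u x ∧ ∀ y, G.Adj x y → y = u
  exists_fixed : ∀ σ : G ≃g G, (∀ i, ¬ G.Adj i (σ i)) → ∃ v, σ v = v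

theorem adj_iff_of_reindex_eq {V W : Type*} {G : SimpleGraph V} {e : V ≃ W} {M : Matrix W W ℤ}
    (h : (graphCartanMatrix G).reindex e e = M) (u v : V) :
    G.Adj u v ↔ M (e u) (e v) = -1 := by
  rw [← h]
  by_cases huv : u = v
  · simp [graphCartanMatrix, huv]
  · by_cases ha : G.Adj u v <;> simp [graphCartanMatrix, huv, ha]

/-- If every vertex other than `v₀` has a neighbour of smaller rank, the graph is connected. -/
theorem SimpleGraph.preconnected_of_rank {V : Type*} {G : SimpleGraph V} (f : V → ℕ) (v₀ : V)
    (h : ∀ v, v ≠ v₀ → ∃ w, G.Adj v w ∧ f w < f v) : G.Preconnected := by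
  have key : ∀ n v, f v = n → G.Reachable v v₀ := by
    intro n
    induction n using Nat.strong_induction_on with
    | _ n ih =>
      intro v hv
      by_cases hvv : v = v₀
      · rw [hvv]
      · obtain ⟨w, hw, hlt⟩ := h v hvv
        exact hw.reachable.trans (ih _ (hv ▸ hlt) w rfl)
  exact fun u v => (key _ u rfl).trans (key _ v rfl).symm

theorem SimpleGraph.Preconnected.induction {V : Type*} {G : SimpleGraph V} (hG : G.Preconnected)
    {P : V → Prop} (v₀ : V) (h₀ : P v₀) (h : ∀ v w, G.Adj v w → P v → P w) (v : V) : P v := by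
  have hr := (SimpleGraph.reachable_iff_reflTransGen v₀ v).1 (hG v₀ v)
  induction hr with
  | refl => exact h₀
  | tail _ hab ih => exact h _ _ hab ih

/-- If exactly one vertex has at least three neighbours, every automorphism fixes it. -/
theorem exists_fixed_of_unique_branch {V : Type*} {G : SimpleGraph V} {u a b c : V}
    (ha : G.Adj u a) (hb : G.Adj u b) (hc : G.Adj u c) (hab : a ≠ b) (hac : a ≠ c) (hbc : b ≠ c)
    (huniq : ∀ u' a' b' c' : V, G.Adj u' a' → G.Adj u' b' → G.Adj u' c' → a' ≠ b' → a' ≠ c' →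
      b' ≠ c' → u' = u) (σ : G ≃g G) : ∃ v, σ v = v :=
  ⟨u, huniq _ _ _ _ (σ.map_adj_iff.2 ha) (σ.map_adj_iff.2 hb) (σ.map_adj_iff.2 hc)
    (σ.injective.ne hab) (σ.injective.ne hac) (σ.injective.ne hbc)⟩

/-- Paths have the required shape. For the fixed vertex, let `v` be the first vertex that is not
moved forward: since `σ` moves no vertex to its neighbour, it cannot be moved backward either. -/
theorem hasDynkinShape_of_path {V : Type*} {G : SimpleGraph V} {n : ℕ} (hn : 1 ≤ n)
    (e : V ≃ Fin n)
    (h : ∀ u v, G.Adj u v ↔ (e u).val + 1 = (e v).val ∨ (e v).val + 1 = (e u).val) :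
    HasDynkinShape G where
  preconnected := by
    refine SimpleGraph.preconnected_of_rank (fun v => (e v).val) (e.symm ⟨0, hn⟩) fun v hv => ?_
    have h0 : (e v).val ≠ 0 := fun h0 => hv (e.injective (by simp [Fin.ext_iff, h0]))
    refine ⟨e.symm ⟨(e v).val - 1, by omega⟩, ?_, ?_⟩
    · rw [h]
      simp
      omega
    · simp
      omega
  branch := by
    intro u a b c ha hb hc hab hac hbc
    rw [h] at ha hb hc
    rw [← e.injective.ne_iff, Ne, Fin.ext_iff] at hab hac hbc
    omega
  exists_fixed := by
    intro σ hσ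
    have hex : ∃ k : ℕ, ∃ v, (e v).val = k ∧ (e (σ v)).val ≤ k := by
      refine ⟨n - 1, e.symm ⟨n - 1, by omega⟩, by simp, ?_⟩
      have := (e (σ (e.symm ⟨n - 1, by omega⟩))).isLt
      omega
    obtain ⟨v, hv, hle⟩ := Nat.find_spec hex
    refine ⟨v, ?_⟩
    rw [← e.injective.eq_iff, Fin.ext_iff]
    by_contra hne
    have hpos : (e v).val ≠ 0 := by omega
    have hlt := (e v).isLt
    set u := e.symm ⟨(e v).val - 1, by omega⟩ with hu
    have heu : (e u).val = (e v).val - 1 := by simp [hu]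
    have hmin := Nat.find_min hex (m := (e u).val) (by omega)
    have hgt : (e u).val < (e (σ u)).val := by
      by_contra hcon
      exact hmin ⟨u, rfl, by omega⟩
    have h1 : G.Adj u v := (h u v).2 (by omega)
    have h2 := (h _ _).1 (σ.map_adj_iff.2 h1)
    have h3 := hσ u
    rw [h] at h3
    omega

theorem hasDynkinShape_of_D {V : Type*} {G : SimpleGraph V} {n : ℕ} (hn : 4 ≤ n)
    (e : V ≃ Fin n)
    (h : ∀ u v, G.Adj u v ↔ (e u).val + 1 = (e v).val ∧ (e v).val + 2 < n ∨
      (e v).val + 1 = (e u).val ∧ (e u).val + 2 < n ∨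
      (e u).val + 3 = n ∧ ((e v).val + 2 = n ∨ (e v).val + 1 = n) ∨
      (e v).val + 3 = n ∧ ((e u).val + 2 = n ∨ (e u).val + 1 = n)) :
    HasDynkinShape G where
  preconnected := by
    refine SimpleGraph.preconnected_of_rank (fun v => (e v).val) (e.symm ⟨0, by omega⟩)
      fun v hv => ?_
    have h0 : (e v).val ≠ 0 := fun h0 => hv (e.injective (by simp [Fin.ext_iff, h0]))
    have hlt := (e v).isLt
    by_cases hlast : (e v).val + 1 = n
    · refine ⟨e.symm ⟨(e v).val - 2, by omega⟩, ?_, ?_⟩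
      · rw [h]
        simp
        omega
      · simp
        omega
    · refine ⟨e.symm ⟨(e v).val - 1, by omega⟩, ?_, ?_⟩
      · rw [h]
        simp
        omega
      · simp
        omega
  branch := by
    intro u a b c ha hb hc hab hac hbc
    refine ⟨fun x hx => ?_, e.symm ⟨n - 1, by omega⟩, ?_, fun y hy => ?_⟩
    · rw [h] at ha hb hc hx
      simp only [← e.injective.eq_iff, Ne, Fin.ext_iff] at hab hac hbc ⊢
      omega
    · rw [h] at ha hb hc ⊢
      simp only [← e.injective.eq_iff, Ne, Fin.ext_iff] at hab hac hbc
      simp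
      omega
    · rw [h] at ha hb hc hy
      simp only [← e.injective.eq_iff, Ne, Fin.ext_iff] at hab hac hbc ⊢
      simp at hy
      omega
  exists_fixed := by
    intro σ _
    refine exists_fixed_of_unique_branch (u := e.symm ⟨n - 3, by omega⟩)
      (a := e.symm ⟨n - 4, by omega⟩) (b := e.symm ⟨n - 2, by omega⟩)
      (c := e.symm ⟨n - 1, by omega⟩) ?_ ?_ ?_ ?_ ?_ ?_ ?_ σ
    iterate 3 · rw [h]; simp; omega
    iterate 3 · simp; omega
    intro u a b c ha hb hc hab hac hbc
    rw [h] at ha hb hc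
    simp only [← e.injective.eq_iff, Ne, Fin.ext_iff] at hab hac hbc ⊢
    simp
    omega

theorem hasDynkinShape_of_E {V : Type*} {G : SimpleGraph V} {n : ℕ} (hn : 6 ≤ n)
    (e : V ≃ Fin n)
    (h : ∀ u v, G.Adj u v ↔ (2 ≤ (e u).val ∧ (e u).val + 1 = (e v).val) ∨
      (2 ≤ (e v).val ∧ (e v).val + 1 = (e u).val) ∨
      ((e u).val ≤ 1 ∧ (e u).val + 2 = (e v).val) ∨
      ((e v).val ≤ 1 ∧ (e v).val + 2 = (e u).val)) :
    HasDynkinShape G where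
  preconnected := by
    refine SimpleGraph.preconnected_of_rank (fun v => n - (e v).val) (e.symm ⟨n - 1, by omega⟩)
      fun v hv => ?_
    have hlt := (e v).isLt
    have h0 : (e v).val ≠ n - 1 := fun h0 => hv (e.injective (by simp [Fin.ext_iff, h0]))
    by_cases hlast : (e v).val ≤ 1
    · refine ⟨e.symm ⟨(e v).val + 2, by omega⟩, ?_, ?_⟩
      · rw [h]
        simp
        omega
      · simp
        omega
    · refine ⟨e.symm ⟨(e v).val + 1, by omega⟩, ?_, ?_⟩
      · rw [h]
        simp
        omega
      · simp
        omega
  branch := by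
    intro u a b c ha hb hc hab hac hbc
    refine ⟨fun x hx => ?_, e.symm ⟨1, by omega⟩, ?_, fun y hy => ?_⟩
    · rw [h] at ha hb hc hx
      simp only [← e.injective.eq_iff, Ne, Fin.ext_iff] at hab hac hbc ⊢
      omega
    · rw [h] at ha hb hc ⊢
      simp only [← e.injective.eq_iff, Ne, Fin.ext_iff] at hab hac hbc
      simp
      omega
    · rw [h] at ha hb hc hy
      simp only [← e.injective.eq_iff, Ne, Fin.ext_iff] at hab hac hbc ⊢
      simp at hy
      omega
  exists_fixed := by
    intro σ _
    refine exists_fixed_of_unique_branch (u := e.symm ⟨3, by omega⟩)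
      (a := e.symm ⟨1, by omega⟩) (b := e.symm ⟨2, by omega⟩)
      (c := e.symm ⟨4, by omega⟩) ?_ ?_ ?_ ?_ ?_ ?_ ?_ σ
    iterate 3 · rw [h]; simp
    iterate 3 · simp
    intro u a b c ha hb hc hab hac hbc
    rw [h] at ha hb hc
    simp only [← e.injective.eq_iff, Ne, Fin.ext_iff] at hab hac hbc ⊢
    simp
    omega

theorem IsDynkinADE.hasDynkinShape {V : Type*} {G : SimpleGraph V} (hG : IsDynkinADE G) :
    HasDynkinShape G := by
  rcases hG with ⟨n, hn, e, h⟩ | ⟨n, hn, e, h⟩ | ⟨e, h⟩ | ⟨e, h⟩ | ⟨e, h⟩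
  · refine hasDynkinShape_of_path hn e fun u v => ?_
    rw [adj_iff_of_reindex_eq h]
    simp only [CartanMatrix.A, Matrix.of_apply, Fin.ext_iff]
    split_ifs <;> simp <;> omega
  · refine hasDynkinShape_of_D hn e fun u v => ?_
    rw [adj_iff_of_reindex_eq h]
    simp only [CartanMatrix.D, Matrix.of_apply, Fin.ext_iff]
    split_ifs <;> simp <;> omega
  · refine hasDynkinShape_of_E (by omega) e fun u v => ?_
    rw [adj_iff_of_reindex_eq h]
    generalize e u = i
    generalize e v = j
    fin_cases i <;> fin_cases j <;> simp [CartanMatrix.E₆]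
  · refine hasDynkinShape_of_E (by omega) e fun u v => ?_
    rw [adj_iff_of_reindex_eq h]
    generalize e u = i
    generalize e v = j
    fin_cases i <;> fin_cases j <;> simp [CartanMatrix.E₇]
  · refine hasDynkinShape_of_E (by omega) e fun u v => ?_
    rw [adj_iff_of_reindex_eq h]
    generalize e u = i
    generalize e v = j
    fin_cases i <;> fin_cases j <;> simp [CartanMatrix.E₈]

/-! ### Orbits of a diagram automorphism -/

namespace DiagramPair

variable {V : Type*} [Fintype V] (D : DiagramPair V)

theorem orb_eq_orb_iff {v w : V} : D.orb v = D.orb w ↔ D.perm.SameCycle v w :=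
  Quotient.eq (r := Equiv.Perm.SameCycle.setoid D.perm)

theorem orb_perm_pow (k : ℕ) (v : V) : D.orb ((D.perm ^ k) v) = D.orb v :=
  D.orb_eq_orb_iff.2 (Equiv.Perm.sameCycle_pow_left.2 (Equiv.Perm.SameCycle.refl _ _))

theorem orb_perm (v : V) : D.orb (D.perm v) = D.orb v := D.orb_perm_pow 1 v

theorem mem_fiber {v : V} {J : D.I} : v ∈ D.fiber J ↔ D.orb v = J := by simp [fiber]

theorem perm_mem_periodicPts (v : V) : v ∈ Function.periodicPts D.perm :=
  ⟨orderOf D.perm, orderOf_pos _, by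
    rw [Function.IsPeriodicPt, Function.IsFixedPt, Equiv.Perm.iterate_eq_pow, pow_orderOf_eq_one]
    rfl⟩

theorem exists_pow_lt_minimalPeriod {v w : V} (h : D.orb w = D.orb v) :
    ∃ k < Function.minimalPeriod D.perm v, (D.perm ^ k) v = w := by
  obtain ⟨k, hk⟩ := (D.orb_eq_orb_iff.1 h.symm).exists_nat_pow_eq
  refine ⟨k % Function.minimalPeriod D.perm v, Nat.mod_lt _
    (Function.minimalPeriod_pos_of_mem_periodicPts (D.perm_mem_periodicPts v)), ?_⟩
  rw [← Equiv.Perm.iterate_eq_pow, Function.iterate_mod_minimalPeriod_eq,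
    Equiv.Perm.iterate_eq_pow, hk]

theorem d_orb (v : V) : D.d (D.orb v) = Function.minimalPeriod D.perm v := by
  have h : D.fiber (D.orb v) =
      (Finset.range (Function.minimalPeriod D.perm v)).image fun k => (D.perm ^ k) v := by
    ext w
    rw [mem_fiber, Finset.mem_image]
    constructor
    · intro hw
      obtain ⟨k, hk, hkw⟩ := D.exists_pow_lt_minimalPeriod hw
      exact ⟨k, Finset.mem_range.2 hk, hkw⟩
    · rintro ⟨k, -, rfl⟩
      exact D.orb_perm_pow k v
  rw [d, h, Finset.card_image_of_injOn, Finset.card_range]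
  intro j hj k hk hjk
  rw [Finset.coe_range] at hj hk
  exact Function.iterate_injOn_Iio_minimalPeriod hj hk hjk

theorem d_pos (J : D.I) : 0 < D.d J := by
  obtain ⟨v, rfl⟩ := Quotient.exists_rep J
  exact Finset.card_pos.2 ⟨v, D.mem_fiber.2 rfl⟩

theorem exists_orb_eq (J : D.I) : ∃ v, D.orb v = J := Quotient.exists_rep J

theorem exists_pow_eq {v w : V} (h : D.orb w = D.orb v) :
    ∃ k < D.d (D.orb v), (D.perm ^ k) v = w := by
  rw [d_orb]
  exact D.exists_pow_lt_minimalPeriod h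

theorem perm_pow_d (v : V) : (D.perm ^ D.d (D.orb v)) v = v := by
  rw [d_orb, ← Equiv.Perm.iterate_eq_pow, Function.iterate_minimalPeriod]

theorem perm_pow_injOn {v : V} {j k : ℕ} (hj : j < D.d (D.orb v)) (hk : k < D.d (D.orb v))
    (h : (D.perm ^ j) v = (D.perm ^ k) v) : j = k := by
  rw [d_orb] at hj hk
  exact Function.iterate_injOn_Iio_minimalPeriod hj hk h

theorem d_dvd_r (v : V) : D.d (D.orb v) ∣ D.r := by
  rw [d_orb]
  refine Function.IsPeriodicPt.minimalPeriod_dvd ?_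
  rw [Function.IsPeriodicPt, Function.IsFixedPt, Equiv.Perm.iterate_eq_pow, r, pow_orderOf_eq_one]
  rfl

theorem r_pos : 0 < D.r := orderOf_pos _

theorem d_eq_one_iff {v : V} : D.d (D.orb v) = 1 ↔ D.perm v = v := by
  rw [d_orb, Function.minimalPeriod_eq_one_iff_isFixedPt]
  rfl

theorem eq_of_orb_eq_of_d_eq_one {v w : V} (h : D.orb w = D.orb v) (hd : D.d (D.orb v) = 1) :
    w = v := by
  obtain ⟨k, hk, rfl⟩ := D.exists_pow_eq h
  obtain rfl : k = 0 := by omega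
  rfl

theorem adj_perm_pow {v w : V} (h : D.Δ.Adj v w) (k : ℕ) :
    D.Δ.Adj ((D.perm ^ k) v) ((D.perm ^ k) w) := by
  induction k with
  | zero => exact h
  | succ k ih =>
    rw [pow_succ', Equiv.Perm.mul_apply, Equiv.Perm.mul_apply]
    exact D.σ.map_adj_iff.2 ih

theorem adj_perm {v w : V} (h : D.Δ.Adj v w) : D.Δ.Adj (D.perm v) (D.perm w) :=
  D.adj_perm_pow h 1

theorem orbAdj_of_adj {v w : V} (h : D.Δ.Adj v w) : D.orbAdj (D.orb v) (D.orb w) :=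
  ⟨v, w, rfl, rfl, h⟩

theorem orbAdj_symm {J K : D.I} (h : D.orbAdj J K) : D.orbAdj K J := by
  obtain ⟨v, w, hv, hw, hvw⟩ := h
  exact ⟨w, v, hw, hv, hvw.symm⟩

theorem exists_adj_of_orbAdj {v : V} {K : D.I} (h : D.orbAdj (D.orb v) K) :
    ∃ w, D.orb w = K ∧ D.Δ.Adj v w := by
  obtain ⟨v', w, hv, hw, hvw⟩ := h
  obtain ⟨k, -, rfl⟩ := D.exists_pow_eq hv.symm
  exact ⟨_, (D.orb_perm_pow k w).trans hw, D.adj_perm_pow hvw k⟩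

theorem adj_of_fixed {u w w' : V} (hu : D.d (D.orb u) = 1) (h : D.Δ.Adj u w)
    (hw : D.orb w' = D.orb w) : D.Δ.Adj u w' := by
  obtain ⟨k, -, rfl⟩ := D.exists_pow_eq hw
  have h2 := D.adj_perm_pow h k
  rwa [D.eq_of_orb_eq_of_d_eq_one (D.orb_perm_pow k u) hu] at h2

theorem exists_d_eq_one : ∃ v, D.d (D.orb v) = 1 := by
  obtain ⟨v, hv⟩ := D.ade.hasDynkinShape.exists_fixed D.σ D.not_adj
  exact ⟨v, D.d_eq_one_iff.2 hv⟩

theorem exists_adj_of_d_ne_one {v : V} (hv : D.d (D.orb v) ≠ 1) : ∃ w, D.Δ.Adj v w := by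
  obtain ⟨v₀, h₀⟩ := D.exists_d_eq_one
  by_contra! hcon
  refine (D.ade.hasDynkinShape.preconnected.induction (P := fun w => w ≠ v) v₀ ?_ ?_ v) rfl
  · rintro rfl
    exact hv h₀
  · rintro u w huw - rfl
    exact hcon u huw.symm

end DiagramPair

/-! ### The shape of a height function -/

namespace QDatum

variable {V : Type*} [Fintype V] (Q : QDatum V)

theorem abs_sub_of_d_eq {v w : V} (h : Q.Δ.Adj v w) (hd : Q.d (Q.orb v) = Q.d (Q.orb w)) :
    |Q.ξ v - Q.ξ w| = Q.d (Q.orb v) :=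
  Q.isHeight.height_of_eq v w h hd

/-- The second condition on height functions forces the larger of two adjacent orbits of different
sizes to have `r` elements. -/
theorem exists_chain_of_lt {v w : V} (h : Q.Δ.Adj v w) (hd : Q.d (Q.orb v) < Q.d (Q.orb w)) :
    Q.d (Q.orb w) = Q.r ∧ ∃ w₀, Q.orb w₀ = Q.orb w ∧ |Q.ξ v - Q.ξ w₀| = 1 ∧
      ∀ k < Q.d (Q.orb w), Q.ξ ((Q.perm ^ k) w₀) = Q.ξ w₀ - 2 * k := by
  obtain ⟨w₀, ⟨h1, h2, h3⟩, -⟩ := Q.isHeight.height_of_lt _ _ (Q.orbAdj_of_adj h) hd v rfl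
  have hr : Q.d (Q.orb w) = Q.r := by
    refine le_antisymm (Nat.le_of_dvd Q.r_pos (Q.d_dvd_r w)) ?_
    -- the values of the height function separate the `r` vertices `σ^k w₀`
    by_contra! hlt
    have h4 := h3 _ hlt
    rw [← h1, Q.perm_pow_d w₀, h1] at h4
    have := Q.d_pos (Q.orb w)
    omega
  exact ⟨hr, w₀, h1, h2, fun k hk => h3 k (hr ▸ hk)⟩

/-- A nontrivial orbit next to a fixed vertex consists of two or three vertices, because a Dynkin
diagram has no vertex of degree greater than three. -/
theorem r_le_three_of_adj {u w : V} (h : Q.Δ.Adj u w) (hu : Q.d (Q.orb u) = 1)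
    (hw : Q.d (Q.orb w) ≠ 1) : Q.d (Q.orb w) = Q.r ∧ Q.r ≤ 3 := by
  have hpos := Q.d_pos (Q.orb w)
  obtain ⟨hr, -⟩ := Q.exists_chain_of_lt h (by omega)
  refine ⟨hr, ?_⟩
  by_contra! hgt
  have hadj : ∀ k, Q.Δ.Adj u ((Q.perm ^ k) w) := fun k =>
    Q.adj_of_fixed hu h (Q.orb_perm_pow k w)
  have hne : ∀ j k, j < 4 → k < 4 → j ≠ k → (Q.perm ^ j) w ≠ (Q.perm ^ k) w :=
    fun j k hj hk hjk heq => hjk (Q.perm_pow_injOn (by omega) (by omega) heq)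
  have hb := (Q.ade.hasDynkinShape.branch u _ _ _ (hadj 0) (hadj 1) (hadj 2)
    (hne 0 1 (by omega) (by omega) (by omega)) (hne 0 2 (by omega) (by omega) (by omega))
    (hne 1 2 (by omega) (by omega) (by omega))).1 _ (hadj 3)
  rcases hb with hb | hb | hb
  · exact hne 3 0 (by omega) (by omega) (by omega) hb
  · exact hne 3 1 (by omega) (by omega) (by omega) hb
  · exact hne 3 2 (by omega) (by omega) (by omega) hb

theorem exists_adj_d_one {v : V} (hv : Q.d (Q.orb v) ≠ 1) :
    ∃ u w, Q.Δ.Adj u w ∧ Q.d (Q.orb u) = 1 ∧ Q.d (Q.orb w) ≠ 1 := by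
  obtain ⟨v₀, h₀⟩ := Q.exists_d_eq_one
  by_contra! hcon
  exact hv (Q.ade.hasDynkinShape.preconnected.induction (P := fun w => Q.d (Q.orb w) = 1) v₀ h₀
    (fun u w huw hu => hcon u w huw hu) v)

theorem d_eq_r {v : V} (hv : Q.d (Q.orb v) ≠ 1) :
    Q.d (Q.orb v) = Q.r ∧ (Q.r = 2 ∨ Q.r = 3) := by
  obtain ⟨u, w, huw, hu, hw⟩ := Q.exists_adj_d_one hv
  obtain ⟨h1, h2⟩ := Q.r_le_three_of_adj huw hu hw
  have h3 := Q.d_pos (Q.orb w)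
  have hr : Q.r = 2 ∨ Q.r = 3 := by omega
  refine ⟨?_, hr⟩
  have hp : Q.r.Prime := by
    rcases hr with hr | hr <;> rw [hr]
    · exact Nat.prime_two
    · exact Nat.prime_three
  exact ((Nat.dvd_prime hp).1 (Q.d_dvd_r v)).resolve_left hv

theorem chain_of_lt {v w : V} (h : Q.Δ.Adj v w) (hd : Q.d (Q.orb v) < Q.d (Q.orb w)) :
    Q.d (Q.orb v) = 1 ∧ ∃ w₀, Q.orb w₀ = Q.orb w ∧ |Q.ξ v - Q.ξ w₀| = 1 ∧
      ∀ k < Q.d (Q.orb w), Q.ξ ((Q.perm ^ k) w₀) = Q.ξ w₀ - 2 * k := by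
  obtain ⟨hr, hw⟩ := Q.exists_chain_of_lt h hd
  refine ⟨?_, hw⟩
  by_contra hv
  have := (Q.d_eq_r hv).1
  omega

theorem d_cases {v w : V} (h : Q.Δ.Adj v w) : Q.d (Q.orb v) = Q.d (Q.orb w) ∨
    (Q.d (Q.orb v) = 1 ∧ 1 < Q.d (Q.orb w)) ∨ (Q.d (Q.orb w) = 1 ∧ 1 < Q.d (Q.orb v)) := by
  have := Q.d_pos (Q.orb v)
  have := Q.d_pos (Q.orb w)
  rcases lt_trichotomy (Q.d (Q.orb v)) (Q.d (Q.orb w)) with hlt | heq | hgt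
  · have := (Q.chain_of_lt h hlt).1
    omega
  · exact Or.inl heq
  · have := (Q.chain_of_lt h.symm hgt).1
    omega

/-- Along `σ` the height function drops by `2` modulo `2 d`. Starting from a fixed vertex, this
property spreads along the edges of the diagram. -/
theorem two_d_dvd (v : V) : 2 * (Q.d (Q.orb v) : ℤ) ∣ Q.ξ (Q.perm v) - Q.ξ v + 2 := by
  have hone : ∀ w, Q.d (Q.orb w) = 1 → 2 * (Q.d (Q.orb w) : ℤ) ∣ Q.ξ (Q.perm w) - Q.ξ w + 2 := by
    intro w hw
    rw [Q.d_eq_one_iff.1 hw, hw]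
    simp
  obtain ⟨v₀, h₀⟩ := Q.exists_d_eq_one
  refine Q.ade.hasDynkinShape.preconnected.induction
    (P := fun v => 2 * (Q.d (Q.orb v) : ℤ) ∣ Q.ξ (Q.perm v) - Q.ξ v + 2) v₀ (hone v₀ h₀) ?_ v
  intro u w huw hu
  rcases lt_trichotomy (Q.d (Q.orb u)) (Q.d (Q.orb w)) with hlt | heq | hgt
  · obtain ⟨-, w₀, hw, -, hchain⟩ := Q.chain_of_lt huw hlt
    obtain ⟨k, hk, rfl⟩ := Q.exists_pow_eq hw.symm
    rw [Q.orb_perm_pow] at hchain ⊢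
    rw [← Equiv.Perm.mul_apply, ← pow_succ', hchain k hk]
    rcases Nat.lt_or_ge (k + 1) (Q.d (Q.orb w₀)) with hk' | hk'
    · rw [hchain _ hk']
      push_cast
      ring_nf
      exact dvd_zero _
    · have hk1 : k + 1 = Q.d (Q.orb w₀) := by omega
      rw [hk1, Q.perm_pow_d, ← hk1]
      push_cast
      ring_nf
      exact dvd_rfl
  · have h1 := Q.abs_sub_of_d_eq huw heq
    have h2 := Q.abs_sub_of_d_eq (Q.adj_perm huw) (by rw [Q.orb_perm, Q.orb_perm, heq])
    rw [Q.orb_perm] at h2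
    rw [← heq]
    obtain ⟨m, hm⟩ := hu
    rcases abs_eq_abs.1 (h1.trans (Nat.abs_cast _).symm) with h1 | h1 <;>
      rcases abs_eq_abs.1 (h2.trans (Nat.abs_cast _).symm) with h2 | h2
    · exact ⟨m, by linarith⟩
    · exact ⟨m + 1, by linarith⟩
    · exact ⟨m - 1, by linarith⟩
    · exact ⟨m, by linarith⟩
  · exact hone w (Q.chain_of_lt huw.symm hgt).1

theorem two_d_dvd_pow (v : V) (k : ℕ) :
    2 * (Q.d (Q.orb v) : ℤ) ∣ Q.ξ ((Q.perm ^ k) v) - Q.ξ v + 2 * k := by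
  induction k with
  | zero => simp
  | succ k ih =>
    have h := Q.two_d_dvd ((Q.perm ^ k) v)
    rw [Q.orb_perm_pow] at h
    rw [pow_succ', Equiv.Perm.mul_apply]
    have h2 := dvd_add ih h
    push_cast
    ring_nf at h2 ⊢
    exact h2

theorem even_sub_of_orb_eq {v w : V} (h : Q.orb w = Q.orb v) : (2 : ℤ) ∣ Q.ξ w - Q.ξ v := by
  obtain ⟨k, -, rfl⟩ := Q.exists_pow_eq h
  have := (Dvd.intro _ rfl : (2 : ℤ) ∣ 2 * (Q.d (Q.orb v) : ℤ)).trans (Q.two_d_dvd_pow v k)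
  omega

/-- Vertices of one orbit are separated by the height function modulo `2 d`. -/
theorem eq_of_dvd_sub {v w : V} (h : Q.orb w = Q.orb v)
    (hd : 2 * (Q.d (Q.orb v) : ℤ) ∣ Q.ξ w - Q.ξ v) : w = v := by
  obtain ⟨k, hk, rfl⟩ := Q.exists_pow_eq h
  have h1 := dvd_sub (Q.two_d_dvd_pow v k) hd
  rw [add_sub_cancel_left] at h1
  have h2 : (Q.d (Q.orb v) : ℤ) ∣ k := (mul_dvd_mul_iff_left two_ne_zero).1 h1
  have h3 : k = 0 := Nat.eq_zero_of_dvd_of_lt (Int.natCast_dvd_natCast.1 h2) hk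
  simp [h3]

/-- For an automorphism of order three the diagram is of type `D₄`: the fixed vertex next to a
nontrivial orbit is a branch vertex all of whose neighbours are leaves. -/
theorem exists_fixed_adj_of_two_lt {v : V} (hv : 2 < Q.d (Q.orb v)) :
    ∃ u, Q.Δ.Adj u v ∧ Q.d (Q.orb u) = 1 := by
  obtain ⟨u, w, huw, hu, hw⟩ := Q.exists_adj_d_one (v := v) (by omega)
  have hdw : Q.d (Q.orb w) = 3 := by
    have h1 := Q.d_eq_r hw
    have h2 := Q.d_eq_r (v := v) (by omega)
    omega
  have hadj : ∀ k, Q.Δ.Adj u ((Q.perm ^ k) w) := fun k =>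
    Q.adj_of_fixed hu huw (Q.orb_perm_pow k w)
  have hne : ∀ j k, j < 3 → k < 3 → j ≠ k → (Q.perm ^ j) w ≠ (Q.perm ^ k) w :=
    fun j k hj hk hjk heq => hjk (Q.perm_pow_injOn (by omega) (by omega) heq)
  obtain ⟨hb1, x, hx, hleaf⟩ := Q.ade.hasDynkinShape.branch u _ _ _ (hadj 0) (hadj 1) (hadj 2)
    (hne 0 1 (by omega) (by omega) (by omega)) (hne 0 2 (by omega) (by omega) (by omega))
    (hne 1 2 (by omega) (by omega) (by omega))
  have horb : ∀ y, Q.Δ.Adj u y → Q.orb y = Q.orb w := by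
    intro y hy
    rcases hb1 y hy with h | h | h <;> rw [h, Q.orb_perm_pow]
  have hall : ∀ y, y = u ∨ Q.orb y = Q.orb w := by
    refine Q.ade.hasDynkinShape.preconnected.induction
      (P := fun y => y = u ∨ Q.orb y = Q.orb w) u (Or.inl rfl) ?_
    rintro y z hyz (rfl | hy)
    · exact Or.inr (horb z hyz)
    · refine Or.inl ?_
      obtain ⟨k, -, hk⟩ := Q.exists_pow_eq ((horb x hx).trans hy.symm)
      have h1 := hleaf _ (hk ▸ Q.adj_perm_pow hyz k)
      have h2 : (Q.perm ^ k) u = u := Q.eq_of_orb_eq_of_d_eq_one (Q.orb_perm_pow k u) hu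
      exact (Q.perm ^ k).injective (h1.trans h2.symm)
  refine ⟨u, Q.adj_of_fixed hu huw ((hall v).resolve_left ?_), hu⟩
  rintro rfl
  omega

end QDatum

/-! ### Rational weights -/

theorem weightToRat_sum {V ι : Type*} (s : Finset ι) (f : ι → WeightLattice V) :
    weightToRat (∑ a ∈ s, f a) = ∑ a ∈ s, weightToRat (f a) := by
  ext v
  simp [weightToRat, Finset.sum_apply]

/-! ### The folded Cartan matrix -/

namespace QDatum

variable {V : Type*} [Fintype V] (Q : QDatum V)

/-- Adjacent vertices lie in different orbits. In an orbit of two elements this is the condition on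
`σ`; in an orbit of three elements, adjacent vertices would differ in height by `3`, whereas the
heights in an orbit have the same parity. -/
theorem orb_ne_of_adj {v w : V} (h : Q.Δ.Adj v w) : Q.orb v ≠ Q.orb w := by
  intro heq
  have habs := Q.abs_sub_of_d_eq h (by rw [heq])
  have heven := Q.even_sub_of_orb_eq heq
  obtain ⟨k, hk, hkw⟩ := Q.exists_pow_eq heq.symm
  have hd : Q.d (Q.orb v) = 1 ∨ Q.d (Q.orb v) = 2 ∨ Q.d (Q.orb v) = 3 := by
    by_cases h1 : Q.d (Q.orb v) = 1
    · exact Or.inl h1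
    · have := Q.d_eq_r h1
      omega
  rcases hd with hd | hd | hd
  · obtain rfl : k = 0 := by omega
    exact h.ne hkw
  · obtain rfl | rfl : k = 0 ∨ k = 1 := by omega
    · exact h.ne hkw
    · exact Q.not_adj v (hkw ▸ h)
  · rw [hd] at habs
    push_cast at habs
    rcases abs_choice (Q.ξ v - Q.ξ w) with h1 | h1 <;> omega

theorem ne_of_orbAdj {J K : Q.I} (h : Q.orbAdj J K) : J ≠ K := by
  obtain ⟨v, w, rfl, rfl, hvw⟩ := h
  exact Q.orb_ne_of_adj hvw

theorem d_cases_of_orbAdj {J K : Q.I} (h : Q.orbAdj J K) : Q.d J = Q.d K ∨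
    (Q.d J = 1 ∧ 1 < Q.d K) ∨ (Q.d K = 1 ∧ 1 < Q.d J) := by
  obtain ⟨v, w, rfl, rfl, hvw⟩ := h
  exact Q.d_cases hvw

theorem neg_c_toNat_of_le {J K : Q.I} (h : Q.orbAdj J K) (hd : Q.d K ≤ Q.d J) :
    (-Q.c J K).toNat = 1 := by
  have hJ : (0 : ℚ) < Q.d J := by exact_mod_cast Q.d_pos J
  have hK : (0 : ℚ) < Q.d K := by exact_mod_cast Q.d_pos K
  have hceil : ⌈(Q.d K : ℚ) / (Q.d J : ℚ)⌉ = 1 := by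
    rw [Int.ceil_eq_iff]
    push_cast
    refine ⟨by rw [sub_self]; positivity, ?_⟩
    rw [div_le_one hJ]
    exact_mod_cast hd
  rw [DiagramPair.c, if_neg (Q.ne_of_orbAdj h), if_pos h, hceil]
  rfl

theorem neg_c_toNat_of_d_eq_one {J K : Q.I} (h : Q.orbAdj J K) (hd : Q.d J = 1) :
    (-Q.c J K).toNat = Q.d K := by
  rw [DiagramPair.c, if_neg (Q.ne_of_orbAdj h), if_pos h, hd]
  simp

theorem two_dvd_sub_add_min {v w : V} (h : Q.Δ.Adj v w) :
    (2 : ℤ) ∣ Q.ξ w - Q.ξ v + min (Q.d (Q.orb v) : ℤ) (Q.d (Q.orb w)) := by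
  have hlt : ∀ v w : V, Q.Δ.Adj v w → Q.d (Q.orb v) = 1 → 1 < Q.d (Q.orb w) →
      (2 : ℤ) ∣ Q.ξ w - Q.ξ v + 1 := by
    intro v w h hv hw
    obtain ⟨-, w₀, hw₀, habs, -⟩ := Q.chain_of_lt h (by omega)
    have := Q.even_sub_of_orb_eq hw₀
    rcases abs_choice (Q.ξ v - Q.ξ w₀) with h1 | h1 <;> omega
  rcases Q.d_cases h with heq | ⟨hv, hw⟩ | ⟨hw, hv⟩
  · have := Q.abs_sub_of_d_eq h heq
    rcases abs_choice (Q.ξ v - Q.ξ w) with h1 | h1 <;> omega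
  · have := hlt v w h hv hw
    omega
  · have := hlt w v h.symm hw hv
    omega

theorem even_shift {i j : V} (h : Q.orbAdj (Q.orb j) (Q.orb i)) : Even (Q.shift i j) := by
  rw [even_iff_two_dvd, shift]
  obtain ⟨j', hj', hadj⟩ := Q.exists_adj_of_orbAdj (Q.orbAdj_symm h)
  have h1 := Q.two_dvd_sub_add_min hadj
  have h2 := Q.even_sub_of_orb_eq hj'
  rw [hj'] at h1
  omega

/-! ### Mesh systems -/

/-- A family `Ψ J p` of weights, indexed by the orbits and the integers, that is shifted by the
operator `T` and satisfies the mesh relations. For the weights `τ^((ξ_j - p) / 2) ϖ_j` with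
`j ∈ J`, the mesh relations are the `𝔤`-additive property with fundamental weights in place of
the `γ_j` and the Cartan matrix in place of its transpose. -/
structure IsMeshSystem (Ψ : Q.I → ℤ → WeightLattice V)
    (T : WeightLattice V ≃ₗ[ℤ] WeightLattice V) : Prop where
  shift : ∀ J p, Ψ J (p - 2) = T (Ψ J p)
  mesh : ∀ v p, 2 ∣ p - Q.ξ v →
    Ψ (Q.orb v) p + Ψ (Q.orb v) (p - 2 * Q.d (Q.orb v)) =
      ∑ K : Q.I with Q.orbAdj K (Q.orb v), ∑ t ∈ Finset.range (-Q.c (Q.orb v) K).toNat,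
        Ψ K (p - min (Q.d (Q.orb v) : ℤ) (Q.d K) - 2 * t)

/-- The family `Ψ` takes the value `ϖ_v` at the height `η v` of the vertex `v`. -/
def IsNormalizedAt (Ψ : Q.I → ℤ → WeightLattice V) (η : V → ℤ) : Prop :=
  ∀ v, Ψ (Q.orb v) (η v) = fundWeight v

variable {Q} {Ψ : Q.I → ℤ → WeightLattice V} {T : WeightLattice V ≃ₗ[ℤ] WeightLattice V}

theorem shift_zpow (h : ∀ J p, Ψ J (p - 2) = T (Ψ J p)) (J : Q.I) (p m : ℤ) :
    Ψ J (p - 2 * m) = (T ^ m) (Ψ J p) := by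
  induction m using Int.induction_on with
  | zero => simp
  | succ m ih =>
    rw [add_comm, zpow_one_add, LinearEquiv.mul_apply, ← ih, ← h]
    congr 1
    ring
  | pred m ih =>
    have h1 := h J (p - 2 * (-m - 1))
    rw [show p - 2 * (-(m : ℤ) - 1) - 2 = p - 2 * (-m) by ring, ih] at h1
    rw [sub_eq_add_neg (-(m : ℤ)), add_comm (-(m : ℤ)), zpow_add, zpow_neg_one,
      LinearEquiv.mul_apply, h1, ← LinearEquiv.mul_apply, inv_mul_cancel]
    exact congrArg (Ψ J) (by ring)

/-- The mesh relation at one height implies the mesh relations at all heights of this parity. -/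
theorem mesh_of_mesh_at (h : ∀ J p, Ψ J (p - 2) = T (Ψ J p)) {J : Q.I} {p q : ℤ}
    (hpq : 2 ∣ p - q)
    (hmesh : Ψ J p + Ψ J (p - 2 * Q.d J) =
      ∑ K : Q.I with Q.orbAdj K J, ∑ t ∈ Finset.range (-Q.c J K).toNat,
        Ψ K (p - min (Q.d J : ℤ) (Q.d K) - 2 * t)) :
    Ψ J q + Ψ J (q - 2 * Q.d J) =
      ∑ K : Q.I with Q.orbAdj K J, ∑ t ∈ Finset.range (-Q.c J K).toNat,
        Ψ K (q - min (Q.d J : ℤ) (Q.d K) - 2 * t) := by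
  obtain ⟨m, hm⟩ := hpq
  obtain rfl : q = p - 2 * m := by omega
  have h1 := congrArg (T ^ m) hmesh
  simp only [map_add, map_sum, ← shift_zpow h] at h1
  convert h1 using 3
  · ring_nf
  · congr 1
    ring

/-- The mesh relations are stable under a linear change of coordinates. -/
theorem IsMeshSystem.conj (h : Q.IsMeshSystem Ψ T) (s : WeightLattice V ≃ₗ[ℤ] WeightLattice V) :
    Q.IsMeshSystem (fun J p => s (Ψ J p)) (s * T * s⁻¹) where
  shift J p := by
    rw [h.shift, LinearEquiv.mul_apply, LinearEquiv.mul_apply, ← LinearEquiv.mul_apply s⁻¹,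
      inv_mul_cancel]
    rfl
  mesh v p hp := by
    have h1 := congrArg s (h.mesh v p hp)
    simpa only [map_add, map_sum] using h1

/-- Subtracting two mesh relations of the orbit `J` turns the multiplicities `-c J K` of the
relation for the `Ψ K` into the multiplicities `-c K J` of the relation for their differences. -/
theorem sum_range_sub_eq {J K : Q.I} (h : Q.orbAdj K J) (f : ℤ → WeightLattice V) (q : ℤ) :
    ∑ t ∈ Finset.range (-Q.c J K).toNat, (f (q - 2 * t) - f (q - 2 * t - 2 * Q.d J)) =
      ∑ t ∈ Finset.range (-Q.c K J).toNat, (f (q - 2 * t) - f (q - 2 * t - 2 * Q.d K)) := by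
  have key : ∀ n : ℕ, ∑ t ∈ Finset.range n, (f (q - 2 * t) - f (q - 2 * t - 2 * (1 : ℕ))) =
      f q - f (q - 2 * n) := by
    intro n
    have h1 := Finset.sum_range_sub' (fun t : ℕ => f (q - 2 * t)) n
    simp only [Nat.cast_zero, mul_zero, sub_zero] at h1
    rw [← h1]
    refine Finset.sum_congr rfl fun t _ => ?_
    congr 2
    push_cast
    ring
  rcases Q.d_cases_of_orbAdj h with heq | ⟨hK, hJ⟩ | ⟨hJ, hK⟩
  · rw [Q.neg_c_toNat_of_le h heq.ge, Q.neg_c_toNat_of_le (Q.orbAdj_symm h) heq.le, heq]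
  · rw [Q.neg_c_toNat_of_d_eq_one h hK, Q.neg_c_toNat_of_le (Q.orbAdj_symm h) (by omega), hK, key]
    simp
  · rw [Q.neg_c_toNat_of_d_eq_one (Q.orbAdj_symm h) hJ, Q.neg_c_toNat_of_le h (by omega), hJ, key]
    simp

theorem tau_zpow_gamma (h : Q.IsMeshSystem Ψ Q.tau) (hΨ : Q.IsNormalizedAt Ψ Q.ξ) (j : V)
    (m : ℤ) : (Q.tau ^ m) (Q.gamma j) =
      Ψ (Q.orb j) (Q.ξ j - 2 * m) - Ψ (Q.orb j) (Q.ξ j - 2 * m - 2 * Q.d (Q.orb j)) := by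
  rw [gamma, ← hΨ j, ← zpow_natCast, ← shift_zpow h.shift, map_sub, ← shift_zpow h.shift,
    ← shift_zpow h.shift]
  congr 2
  ring

/-- The terms of the additive property depend on the vertex `j` only through its orbit. -/
theorem tau_zpow_shift_gamma (h : Q.IsMeshSystem Ψ Q.tau) (hΨ : Q.IsNormalizedAt Ψ Q.ξ) {i j : V}
    (hij : Q.orbAdj (Q.orb j) (Q.orb i)) (l t : ℤ) :
    (Q.tau ^ (l + t + Q.shift i j / 2)) (Q.gamma j) =
      Ψ (Q.orb j) (Q.ξ i - 2 * l - min (Q.d (Q.orb i) : ℤ) (Q.d (Q.orb j)) - 2 * t) -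
      Ψ (Q.orb j) (Q.ξ i - 2 * l - min (Q.d (Q.orb i) : ℤ) (Q.d (Q.orb j)) - 2 * t -
        2 * Q.d (Q.orb j)) := by
  rw [tau_zpow_gamma h hΨ]
  have h1 := Int.two_mul_ediv_two_of_even (Q.even_shift hij)
  have h2 : Q.ξ j - 2 * (l + t + Q.shift i j / 2) =
      Q.ξ i - 2 * l - min (Q.d (Q.orb i) : ℤ) (Q.d (Q.orb j)) - 2 * t := by
    rw [mul_add, h1, shift]
    ring
  rw [h2]

theorem additive_property_orbits (h : Q.IsMeshSystem Ψ Q.tau) (hΨ : Q.IsNormalizedAt Ψ Q.ξ)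
    (i : V) (l : ℤ) :
    (Q.tau ^ l) (Q.gamma i) + (Q.tau ^ (l + (Q.d (Q.orb i) : ℤ))) (Q.gamma i) =
      ∑ K : Q.I with Q.orbAdj K (Q.orb i), ∑ t ∈ Finset.range (-Q.c K (Q.orb i)).toNat,
        (Ψ K (Q.ξ i - 2 * l - min (Q.d (Q.orb i) : ℤ) (Q.d K) - 2 * t) -
          Ψ K (Q.ξ i - 2 * l - min (Q.d (Q.orb i) : ℤ) (Q.d K) - 2 * t - 2 * Q.d K)) := by
  have h1 := h.mesh i (Q.ξ i - 2 * l) ⟨-l, by ring⟩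
  have h2 := h.mesh i (Q.ξ i - 2 * l - 2 * Q.d (Q.orb i)) ⟨-l - Q.d (Q.orb i), by ring⟩
  have h3 := congrArg₂ (· - ·) h1 h2
  simp only [← Finset.sum_sub_distrib] at h3
  rw [tau_zpow_gamma h hΨ, tau_zpow_gamma h hΨ]
  calc _ = _ := by
        rw [show Q.ξ i - 2 * (l + (Q.d (Q.orb i) : ℤ)) = Q.ξ i - 2 * l - 2 * Q.d (Q.orb i) by ring]
        abel
    _ = _ := h3
    _ = _ := by
        refine Finset.sum_congr rfl fun K hK => ?_
        rw [← sum_range_sub_eq (Finset.mem_filter.1 hK).2]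
        refine Finset.sum_congr rfl fun t _ => ?_
        congr 2
        ring

theorem additive_property_of_isMeshSystem (h : Q.IsMeshSystem Ψ Q.tau)
    (hΨ : Q.IsNormalizedAt Ψ Q.ξ) (S : Finset V) (hS : Set.BijOn Q.orb (S : Set V) Set.univ)
    (i : V) (l : ℤ) :
    (Q.tau ^ l) (Q.gamma i) + (Q.tau ^ (l + (Q.d (Q.orb i) : ℤ))) (Q.gamma i) =
      ∑ j ∈ S with Q.orbAdj (Q.orb j) (Q.orb i),
        ∑ t ∈ Finset.range (-Q.c (Q.orb j) (Q.orb i)).toNat,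
          (Q.tau ^ (l + (t : ℤ) + Q.shift i j / 2)) (Q.gamma j) := by
  rw [additive_property_orbits h hΨ]
  symm
  refine Finset.sum_bij (fun j _ => Q.orb j) ?_ ?_ ?_ ?_
  · intro j hj
    exact Finset.mem_filter.2 ⟨Finset.mem_univ _, (Finset.mem_filter.1 hj).2⟩
  · intro j hj k hk hjk
    exact hS.injOn (Finset.mem_filter.1 hj).1 (Finset.mem_filter.1 hk).1 hjk
  · intro K hK
    obtain ⟨j, hj, rfl⟩ := hS.surjOn (Set.mem_univ K)
    exact ⟨j, Finset.mem_filter.2 ⟨hj, (Finset.mem_filter.1 hK).2⟩, rfl⟩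
  · intro j hj
    exact Finset.sum_congr rfl fun t _ =>
      tau_zpow_shift_gamma h hΨ (Finset.mem_filter.1 hj).2 l t

theorem averaged_additive_property_of_isMeshSystem (h : Q.IsMeshSystem Ψ Q.tau)
    (hΨ : Q.IsNormalizedAt Ψ Q.ξ) (i : V) (l : ℤ) :
    weightToRat
        ((Q.tau ^ l) (Q.gamma i) + (Q.tau ^ (l + (Q.d (Q.orb i) : ℤ))) (Q.gamma i)) =
      ∑ J : Q.I with Q.orbAdj J (Q.orb i),
        ∑ t ∈ Finset.range (-Q.c J (Q.orb i)).toNat,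
          (1 / (Q.d J : ℚ)) •
            ∑ j ∈ Q.fiber J,
              weightToRat ((Q.tau ^ (l + (t : ℤ) + Q.shift i j / 2)) (Q.gamma j)) := by
  rw [additive_property_orbits h hΨ, weightToRat_sum]
  refine Finset.sum_congr rfl fun J hJ => ?_
  rw [weightToRat_sum]
  refine Finset.sum_congr rfl fun t _ => ?_
  have hadj := (Finset.mem_filter.1 hJ).2
  have hconst : ∀ j ∈ Q.fiber J,
      weightToRat ((Q.tau ^ (l + (t : ℤ) + Q.shift i j / 2)) (Q.gamma j)) = weightToRat
        (Ψ J (Q.ξ i - 2 * l - min (Q.d (Q.orb i) : ℤ) (Q.d J) - 2 * t) -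
          Ψ J (Q.ξ i - 2 * l - min (Q.d (Q.orb i) : ℤ) (Q.d J) - 2 * t - 2 * Q.d J)) := by
    intro j hj
    obtain rfl := Q.mem_fiber.1 hj
    rw [tau_zpow_shift_gamma h hΨ hadj]
  have hd : (Q.d J : ℚ) ≠ 0 := by exact_mod_cast (Q.d_pos J).ne'
  rw [Finset.sum_congr rfl hconst, Finset.sum_const, ← Nat.cast_smul_eq_nsmul ℚ, smul_smul]
  rw [show (Q.fiber J).card = Q.d J from rfl, one_div_mul_cancel hd, one_smul]

end QDatum

/-! ### Simple reflections and fundamental weights -/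

section Reflections

variable {V : Type*} [Fintype V] (G : SimpleGraph V)

theorem simpleReflection_fundWeight_of_ne {u v : V} (h : u ≠ v) :
    simpleReflection G v (fundWeight u) = fundWeight u := by
  rw [simpleReflection, Module.reflection_apply]
  simp [fundWeight, h.symm]

theorem simpleReflection_fundWeight_self (v : V) :
    simpleReflection G v (fundWeight v) = ∑ u : V with G.Adj v u, fundWeight u - fundWeight v := by
  rw [simpleReflection, Module.reflection_apply, simpleRoot]
  simp only [LinearMap.coe_proj, Function.eval, fundWeight, Pi.single_eq_same]
  rw [one_smul, two_smul]
  abel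

theorem simpleReflection_mul_self (v : V) : simpleReflection G v * simpleReflection G v = 1 := by
  ext1 x
  exact Module.involutive_reflection _ x

theorem prod_simpleReflection_fundWeight {u : V} {L : List (V × ℤ)} (h : ∀ x ∈ L, u ≠ x.1) :
    (L.map fun x => simpleReflection G x.1).prod (fundWeight u) = fundWeight u := by
  induction L with
  | nil => rfl
  | cons x L ih =>
    rw [List.map_cons, List.prod_cons, LinearEquiv.mul_apply,
      ih fun y hy => h y (List.mem_cons_of_mem x hy)]
    exact simpleReflection_fundWeight_of_ne G (h x List.mem_cons_self)

end Reflections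

namespace QDatum

variable {V : Type*} [Fintype V] (Q : QDatum V)

theorem isCompatibleReading_reading (X : Finset (V × ℤ)) :
    Q.IsCompatibleReading X (Q.reading X) :=
  (Q.exists_isCompatibleReading X).choose_spec

/-! ### The tops of the orbits -/

theorem mem_tops {v : V} : v ∈ Q.tops ↔ ∀ w, Q.orb w = Q.orb v → Q.ξ w ≤ Q.ξ v := by
  simp [tops]

theorem exists_mem_tops (J : Q.I) : ∃ v ∈ Q.tops, Q.orb v = J := by
  obtain ⟨v₀, rfl⟩ := Q.exists_orb_eq J
  obtain ⟨v, hv, hmax⟩ := (Q.fiber (Q.orb v₀)).exists_max_image Q.ξ ⟨v₀, Q.mem_fiber.2 rfl⟩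
  rw [Q.mem_fiber] at hv
  exact ⟨v, Q.mem_tops.2 fun w hw => hmax w (Q.mem_fiber.2 (hw.trans hv)), hv⟩

theorem eq_of_mem_tops {v w : V} (hv : v ∈ Q.tops) (hw : w ∈ Q.tops) (h : Q.orb v = Q.orb w) :
    v = w := by
  refine Q.eq_of_dvd_sub h ?_
  rw [le_antisymm (Q.mem_tops.1 hw v h) (Q.mem_tops.1 hv w h.symm), sub_self]
  exact dvd_zero _

/-- The vertex of the orbit `J` at which the height function is maximal. -/
noncomputable def top (J : Q.I) : V := (Q.exists_mem_tops J).choose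

theorem top_mem_tops (J : Q.I) : Q.top J ∈ Q.tops := (Q.exists_mem_tops J).choose_spec.1

theorem orb_top (J : Q.I) : Q.orb (Q.top J) = J := (Q.exists_mem_tops J).choose_spec.2

theorem top_orb {v : V} (hv : v ∈ Q.tops) : Q.top (Q.orb v) = v :=
  Q.eq_of_mem_tops (Q.top_mem_tops _) hv (Q.orb_top _)

theorem mem_tops_of_d_eq_one {v : V} (hv : Q.d (Q.orb v) = 1) : v ∈ Q.tops :=
  Q.mem_tops.2 fun w hw => by rw [Q.eq_of_orb_eq_of_d_eq_one hw hv]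

theorem pow_notMem_tops {v : V} (hv : v ∈ Q.tops) {k : ℕ} (hk : k < Q.d (Q.orb v)) (h0 : k ≠ 0) :
    (Q.perm ^ k) v ∉ Q.tops := by
  intro h
  exact h0 (Q.perm_pow_injOn hk (Q.d_pos _) (Q.eq_of_mem_tops h hv (Q.orb_perm_pow k v)))

/-- The vertex `j°` of the second condition on height functions is the top of its orbit. -/
theorem chain_top {u v : V} (h : Q.Δ.Adj u v) (hd : Q.d (Q.orb u) < Q.d (Q.orb v))
    (hv : v ∈ Q.tops) : |Q.ξ u - Q.ξ v| = 1 ∧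
      ∀ k < Q.d (Q.orb v), Q.ξ ((Q.perm ^ k) v) = Q.ξ v - 2 * k := by
  obtain ⟨-, w, hw, habs, hchain⟩ := Q.chain_of_lt h hd
  obtain rfl : w = v := by
    refine Q.eq_of_mem_tops (Q.mem_tops.2 fun x hx => ?_) hv hw
    obtain ⟨k, hk, rfl⟩ := Q.exists_pow_eq hx
    rw [hchain k (hw ▸ hk)]
    omega
  exact ⟨habs, hchain⟩

theorem abs_sub_tops {u v : V} (h : Q.Δ.Adj u v) (hu : u ∈ Q.tops) (hv : v ∈ Q.tops) :
    |Q.ξ u - Q.ξ v| = min (Q.d (Q.orb u) : ℤ) (Q.d (Q.orb v)) := by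
  rcases Q.d_cases h with heq | ⟨h1, h2⟩ | ⟨h1, h2⟩
  · rw [Q.abs_sub_of_d_eq h heq, heq, min_self]
  · rw [(Q.chain_top h (by omega) hv).1, h1]
    omega
  · rw [abs_sub_comm, (Q.chain_top h.symm (by omega) hu).1, h1]
    omega

/-! ### The raised height function -/

/-- The smallest function `η ≥ ξ` with `η (σ v) ≥ ξ v - 2`. It differs from `ξ` only at the images
under `σ` of the tops, and there the difference is `2 d` times the number of elements of `X'` above
that vertex. -/
noncomputable def raised (v : V) : ℤ := max (Q.ξ v) (Q.ξ (Q.perm.symm v) - 2)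

theorem orb_perm_symm (v : V) : Q.orb (Q.perm.symm v) = Q.orb v := by
  rw [← Q.orb_perm, Equiv.apply_symm_apply]

theorem raised_of_mem_tops {v : V} (hv : v ∈ Q.tops) : Q.raised v = Q.ξ v := by
  have := Q.mem_tops.1 hv _ (Q.orb_perm_symm v)
  rw [raised]
  omega

theorem two_d_dvd_raised (v : V) : 2 * (Q.d (Q.orb v) : ℤ) ∣ Q.raised v - Q.ξ v := by
  rw [raised]
  rcases max_choice (Q.ξ v) (Q.ξ (Q.perm.symm v) - 2) with h | h <;> rw [h]
  · simp
  · have := Q.two_d_dvd (Q.perm.symm v)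
    rw [Q.orb_perm_symm, Equiv.apply_symm_apply] at this
    obtain ⟨m, hm⟩ := this
    exact ⟨-m, by linarith⟩

/-- The raised function satisfies the first condition on height functions: a maximum changes by
at most `d` along an edge, and its residue modulo `2 d` is known. -/
theorem abs_sub_raised {v w : V} (h : Q.Δ.Adj v w) (hd : Q.d (Q.orb v) = Q.d (Q.orb w)) :
    |Q.raised v - Q.raised w| = Q.d (Q.orb v) := by
  have h1 := Q.abs_sub_of_d_eq h hd
  have hadj : Q.Δ.Adj (Q.perm.symm v) (Q.perm.symm w) := by
    have : Q.Δ.Adj (Q.σ (Q.perm.symm v)) (Q.σ (Q.perm.symm w)) := by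
      change Q.Δ.Adj (Q.perm (Q.perm.symm v)) (Q.perm (Q.perm.symm w))
      simpa using h
    exact Q.σ.map_adj_iff.1 this
  have h2 := Q.abs_sub_of_d_eq hadj (by rw [Q.orb_perm_symm, Q.orb_perm_symm, hd])
  rw [Q.orb_perm_symm] at h2
  have hle : |Q.raised v - Q.raised w| ≤ Q.d (Q.orb v) := by
    rw [raised, raised]
    refine (abs_max_sub_max_le_max _ _ _ _).trans ?_
    rw [sub_sub_sub_cancel_right, h1, h2, max_self]
  have hv := Q.two_d_dvd_raised v
  have hw := Q.two_d_dvd_raised w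
  rw [← hd] at hw
  have hpos := Q.d_pos (Q.orb v)
  obtain ⟨a, ha⟩ := hv
  obtain ⟨b, hb⟩ := hw
  have hd0 : (0 : ℤ) < Q.d (Q.orb v) := by exact_mod_cast hpos
  generalize (Q.d (Q.orb v) : ℤ) = d at *
  obtain ⟨hle1, hle2⟩ := abs_le.1 hle
  -- the difference is an odd multiple `(2 (a - b) + e) d` of `d` with `e = 1` or `e = -1`
  rcases abs_eq hd0.le |>.1 h1 with h3 | h3
  · have h4 : Q.raised v - Q.raised w = d * (2 * (a - b) + 1) := by linarith
    have h5 : 2 * (a - b) + 1 ≤ 1 := by nlinarith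
    have h6 : -1 ≤ 2 * (a - b) + 1 := by nlinarith
    obtain h7 | h7 : 2 * (a - b) + 1 = 1 ∨ 2 * (a - b) + 1 = -1 := by omega
    · rw [h4, h7, mul_one, abs_of_pos hd0]
    · rw [h4, h7, mul_neg_one, abs_neg, abs_of_pos hd0]
  · have h4 : Q.raised v - Q.raised w = d * (2 * (a - b) - 1) := by linarith
    have h5 : 2 * (a - b) - 1 ≤ 1 := by nlinarith
    have h6 : -1 ≤ 2 * (a - b) - 1 := by nlinarith
    obtain h7 | h7 : 2 * (a - b) - 1 = 1 ∨ 2 * (a - b) - 1 = -1 := by omega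
    · rw [h4, h7, mul_one, abs_of_pos hd0]
    · rw [h4, h7, mul_neg_one, abs_neg, abs_of_pos hd0]

/-- On an orbit next to a fixed vertex the height function is not raised. -/
theorem raised_of_adj {u v : V} (h : Q.Δ.Adj u v) (hd : Q.d (Q.orb u) < Q.d (Q.orb v)) :
    Q.raised v = Q.ξ v := by
  obtain ⟨-, w, hw, -, hchain⟩ := Q.chain_of_lt h hd
  obtain ⟨k, hk, rfl⟩ := Q.exists_pow_eq hw.symm
  rw [← hw] at hchain
  rw [raised, max_eq_left]
  rcases k with _ | k
  · obtain ⟨j, hj, hjw⟩ := Q.exists_pow_eq (Q.orb_perm_symm w)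
    rw [pow_zero, Equiv.Perm.one_apply, ← hjw, hchain j hj]
    omega
  · rw [pow_succ', Equiv.Perm.mul_apply, Equiv.symm_apply_apply, ← Equiv.Perm.mul_apply,
      ← pow_succ', hchain _ hk, hchain k (by omega)]
    push_cast
    omega

/-- Starting from the top of an orbit, the raised function drops by `2` at each step. -/
theorem raised_pow {v : V} (hv : v ∈ Q.tops) {k : ℕ} (hk : k < Q.d (Q.orb v)) :
    Q.raised ((Q.perm ^ k) v) = Q.ξ v - 2 * k := by
  rcases Nat.lt_or_ge 2 (Q.d (Q.orb v)) with h2 | h2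
  · obtain ⟨u, hu, hu1⟩ := Q.exists_fixed_adj_of_two_lt h2
    have hlt : Q.d (Q.orb u) < Q.d (Q.orb v) := by omega
    rw [← (Q.chain_top hu hlt hv).2 k hk]
    refine Q.raised_of_adj (Q.adj_of_fixed hu1 hu (Q.orb_perm_pow k v)) ?_
    rwa [Q.orb_perm_pow]
  · rcases k with _ | k
    · simpa using Q.raised_of_mem_tops hv
    · obtain rfl : k = 0 := by omega
      have hd : Q.d (Q.orb v) = 2 := by omega
      have h3 := Q.two_d_dvd v
      have h4 := Q.mem_tops.1 hv _ (Q.orb_perm v)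
      rw [hd] at h3
      rw [zero_add, pow_one, raised, Equiv.symm_apply_apply]
      push_cast at h3 ⊢
      omega

/-! ### The mesh system of the `σ`-Coxeter element -/

theorem mem_XTop {x : V × ℤ} : x ∈ Q.XTop ↔ x.1 ∈ Q.tops ∧ x.2 = Q.ξ x.1 := by
  rw [XTop, Finset.mem_image]
  constructor
  · rintro ⟨v, hv, rfl⟩
    exact ⟨hv, rfl⟩
  · rintro ⟨h1, h2⟩
    exact ⟨x.1, h1, by rw [← h2]⟩

theorem w_XTop_of_notMem {v : V} (hv : v ∉ Q.tops) :
    Q.w Q.XTop (fundWeight v) = fundWeight v := by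
  refine prod_simpleReflection_fundWeight Q.Δ fun x hx => ?_
  rintro rfl
  exact hv (Q.mem_XTop.1 (((Q.isCompatibleReading_reading _).2.1 x).1 hx)).1

/-- Applying the Coxeter word to the fundamental weight of a top `v`, the reflections before `s_v`
in the word act on the neighbours of `v`; these reflections belong to the higher neighbours. -/
theorem w_XTop_of_mem {v : V} (hv : v ∈ Q.tops) :
    fundWeight v + Q.w Q.XTop (fundWeight v) = ∑ u : V with Q.Δ.Adj v u,
      if u ∈ Q.tops ∧ Q.ξ v < Q.ξ u then Q.w Q.XTop (fundWeight u) else fundWeight u := by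
  obtain ⟨hnodup, hmem, hpair⟩ := Q.isCompatibleReading_reading Q.XTop
  have hvL : (v, Q.ξ v) ∈ Q.reading Q.XTop := (hmem _).2 (Q.mem_XTop.2 ⟨hv, rfl⟩)
  have hw : Q.w Q.XTop = ((Q.reading Q.XTop).map fun x => simpleReflection Q.Δ x.1).prod := rfl
  obtain ⟨L₁, L₂, hL⟩ := List.append_of_mem hvL
  have hval : ∀ x ∈ Q.reading Q.XTop, x = (x.1, Q.ξ x.1) := fun x hx =>
    Prod.ext rfl (Q.mem_XTop.1 ((hmem x).1 hx)).2
  rw [hL] at hnodup hmem hpair hval hw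
  rw [List.nodup_append, List.nodup_cons] at hnodup
  rw [List.pairwise_append, List.pairwise_cons] at hpair
  -- a weight fixed by the reflections after position `v` only sees the part of the word before it
  have hsplit : ∀ u, (u, Q.ξ u) ∉ L₂ → Q.w Q.XTop (fundWeight u) =
      (L₁.map fun x => simpleReflection Q.Δ x.1).prod
        (simpleReflection Q.Δ v (fundWeight u)) := by
    intro u hu
    rw [hw, List.map_append, List.prod_append, List.map_cons, List.prod_cons,
      LinearEquiv.mul_apply, LinearEquiv.mul_apply,
      prod_simpleReflection_fundWeight Q.Δ (u := u) (L := L₂)]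
    rintro x hx rfl
    refine hu ?_
    rw [← hval x (by simp [hx])]
    exact hx
  have hvfix : (L₁.map fun x => simpleReflection Q.Δ x.1).prod (fundWeight v) = fundWeight v := by
    refine prod_simpleReflection_fundWeight Q.Δ fun x hx hxv => ?_
    refine hnodup.2.2 x hx (v, Q.ξ v) List.mem_cons_self ?_
    rw [hval x (by simp [hx]), ← hxv]
  rw [hsplit v hnodup.2.1.1, simpleReflection_fundWeight_self, map_sub, map_sum, hvfix,
    add_sub_cancel]
  refine Finset.sum_congr rfl fun u hu => ?_
  have hadj : Q.Δ.Adj v u := (Finset.mem_filter.1 hu).2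
  split_ifs with hif
  · have habs := Q.abs_sub_tops hadj hv hif.1
    rw [hsplit u, simpleReflection_fundWeight_of_ne Q.Δ hadj.ne']
    intro huL
    refine hpair.2.1.1 _ huL ⟨by simp [IsRepVertex], by simp [IsRepVertex], hadj, ?_⟩
    rw [← habs, abs_sub_comm, abs_of_pos (sub_pos.2 hif.2)]
  · refine prod_simpleReflection_fundWeight Q.Δ fun x hx hux => ?_
    have hxL := hval x (by simp [hx])
    rw [← hux] at hxL
    subst hxL
    have hutop : u ∈ Q.tops := (Q.mem_XTop.1 ((hmem (u, Q.ξ u)).1 (by simp [hx]))).1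
    have habs := Q.abs_sub_tops hadj.symm hutop hv
    have hle : Q.ξ u ≤ Q.ξ v := not_lt.1 fun h => hif ⟨hutop, h⟩
    refine hpair.2.2 _ hx _ List.mem_cons_self
      ⟨by simp [IsRepVertex], by simp [IsRepVertex], hadj.symm, ?_⟩
    rw [← habs, abs_sub_comm, abs_of_nonneg (sub_nonneg.2 hle)]

theorem tauTop_fundWeight (v : V) :
    Q.tauTop (fundWeight v) = Q.w Q.XTop (fundWeight (Q.perm v)) := by
  rw [tauTop, LinearEquiv.mul_apply, Q.sigmaAct_fundWeight]
  rfl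

theorem tauTop_pow_fundWeight {v : V} (hv : v ∈ Q.tops) {k : ℕ} (hk : k < Q.d (Q.orb v)) :
    (Q.tauTop ^ k) (fundWeight v) = fundWeight ((Q.perm ^ k) v) := by
  induction k with
  | zero => rfl
  | succ k ih =>
    rw [pow_succ', LinearEquiv.mul_apply, ih (by omega), tauTop_fundWeight,
      ← Equiv.Perm.mul_apply, ← pow_succ',
      Q.w_XTop_of_notMem (Q.pow_notMem_tops hv hk (by omega))]

theorem tauTop_pow_d_fundWeight {v : V} (hv : v ∈ Q.tops) :
    (Q.tauTop ^ Q.d (Q.orb v)) (fundWeight v) = Q.w Q.XTop (fundWeight v) := by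
  have hpos := Q.d_pos (Q.orb v)
  obtain ⟨k, hk⟩ := Nat.exists_eq_succ_of_ne_zero hpos.ne'
  rw [hk, Nat.succ_eq_add_one, pow_succ', LinearEquiv.mul_apply,
    Q.tauTop_pow_fundWeight hv (by omega), tauTop_fundWeight, ← Equiv.Perm.mul_apply, ← pow_succ',
    ← Nat.succ_eq_add_one, ← hk, Q.perm_pow_d]

/-- The mesh system of the `σ`-Coxeter element `τ°`: the translates under `τ°` of the fundamental
weights of the tops. The half-integers that occur when `p` has the wrong parity are rounded. -/
noncomputable def topSystem (J : Q.I) (p : ℤ) : WeightLattice V :=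
  (Q.tauTop ^ ((Q.ξ (Q.top J) - p) / 2)) (fundWeight (Q.top J))

theorem topSystem_shift (J : Q.I) (p : ℤ) :
    Q.topSystem J (p - 2) = Q.tauTop (Q.topSystem J p) := by
  rw [topSystem, topSystem, ← LinearEquiv.mul_apply, ← zpow_one_add]
  congr 2
  omega

theorem topSystem_top {v : V} (hv : v ∈ Q.tops) (k : ℕ) :
    Q.topSystem (Q.orb v) (Q.ξ v - 2 * k) = (Q.tauTop ^ k) (fundWeight v) := by
  rw [topSystem, Q.top_orb hv, ← zpow_natCast]
  congr 2
  omega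

theorem topSystem_isNormalizedAt : Q.IsNormalizedAt Q.topSystem Q.raised := by
  intro u
  have hv := Q.top_mem_tops (Q.orb u)
  have hu : Q.orb u = Q.orb (Q.top (Q.orb u)) := (Q.orb_top _).symm
  obtain ⟨k, hk, hku⟩ := Q.exists_pow_eq hu
  rw [hu]
  generalize Q.top (Q.orb u) = v at *
  subst hku
  rw [Q.raised_pow hv hk, Q.topSystem_top hv, Q.tauTop_pow_fundWeight hv hk]

theorem w_XTop_fundWeight_eq_topSystem {v : V} (hv : v ∈ Q.tops) :
    Q.w Q.XTop (fundWeight v) = Q.topSystem (Q.orb v) (Q.ξ v - 2 * Q.d (Q.orb v)) := by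
  rw [← Q.tauTop_pow_d_fundWeight hv, Q.topSystem_top hv]

/-- A neighbour `u` of a top `t` in an orbit of the same size lies below `t`, unless it is itself
a top: if `u = σ^k t'` with a top `t'` were above `t`, then the heights of `t'` and of its
neighbour `σ^(d - k) t` would differ by `3 d`. -/
theorem raised_lt_of_notMem_tops {t u : V} (h : Q.Δ.Adj t u)
    (hd : Q.d (Q.orb t) = Q.d (Q.orb u)) (ht : t ∈ Q.tops) (hu : u ∉ Q.tops) :
    Q.raised u = Q.ξ t - Q.d (Q.orb t) := by
  have habs := Q.abs_sub_raised h hd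
  rw [Q.raised_of_mem_tops ht] at habs
  rcases abs_choice (Q.ξ t - Q.raised u) with h1 | h1
  · omega
  exfalso
  obtain ⟨t', ht', horb⟩ := Q.exists_mem_tops (Q.orb u)
  obtain ⟨k, hk, rfl⟩ := Q.exists_pow_eq horb.symm
  rw [Q.orb_perm_pow] at hd
  have hk0 : k ≠ 0 := by
    rintro rfl
    exact hu ht'
  have hadj := Q.adj_perm_pow h (Q.d (Q.orb t) - k)
  rw [← Equiv.Perm.mul_apply, ← pow_add, Nat.sub_add_cancel (by omega), hd, Q.perm_pow_d] at hadj
  have habs' := Q.abs_sub_raised hadj (by rw [Q.orb_perm_pow, hd])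
  rw [Q.raised_pow ht (by omega), Q.raised_of_mem_tops ht', Q.orb_perm_pow] at habs'
  rw [Q.raised_pow ht' hk] at habs h1
  rcases abs_choice (Q.ξ t - 2 * ((Q.d (Q.orb t') - k : ℕ) : ℤ) - Q.ξ t') with h2 | h2 <;> omega

/-- The contribution to the mesh relation at a top `t` of a neighbour in an orbit that is not
larger than that of `t`. -/
theorem neighbour_term_of_le {t u : V} (h : Q.Δ.Adj t u) (hd : Q.d (Q.orb u) ≤ Q.d (Q.orb t))
    (ht : t ∈ Q.tops) :
    (if u ∈ Q.tops ∧ Q.ξ t < Q.ξ u then Q.w Q.XTop (fundWeight u) else fundWeight u) =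
      Q.topSystem (Q.orb u) (Q.ξ t - Q.d (Q.orb u)) := by
  by_cases hu : u ∈ Q.tops
  · have habs := Q.abs_sub_tops h ht hu
    rw [min_eq_right (by exact_mod_cast hd)] at habs
    split_ifs with hif
    · rw [Q.w_XTop_fundWeight_eq_topSystem hu]
      congr 1
      rcases abs_choice (Q.ξ t - Q.ξ u) with h1 | h1 <;> omega
    · have hle : Q.ξ u ≤ Q.ξ t := not_lt.1 fun hlt => hif ⟨hu, hlt⟩
      rw [← Q.topSystem_isNormalizedAt u, Q.raised_of_mem_tops hu]
      congr 1
      rcases abs_choice (Q.ξ t - Q.ξ u) with h1 | h1 <;> omega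
  · rw [if_neg fun hif => hu hif.1, ← Q.topSystem_isNormalizedAt u]
    have hd' : Q.d (Q.orb t) = Q.d (Q.orb u) := by
      rcases Q.d_cases h with heq | ⟨h1, h2⟩ | ⟨h1, h2⟩
      · exact heq
      · omega
      · exact absurd (Q.mem_tops_of_d_eq_one h1) hu
    rw [Q.raised_lt_of_notMem_tops h hd' ht hu, hd']

/-- A vertex has at most one neighbour in an orbit that is not larger than its own. -/
theorem neighbour_unique {t u u' : V} (h : Q.Δ.Adj t u) (h' : Q.Δ.Adj t u')
    (horb : Q.orb u' = Q.orb u) (hd : Q.d (Q.orb u) ≤ Q.d (Q.orb t)) : u' = u := by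
  rcases Q.d_cases h with heq | ⟨h1, h2⟩ | ⟨h1, h2⟩
  · have habs := Q.abs_sub_of_d_eq h heq
    have habs' := Q.abs_sub_of_d_eq h' (by rw [horb, heq])
    refine Q.eq_of_dvd_sub horb ?_
    rw [← heq]
    rcases abs_choice (Q.ξ t - Q.ξ u) with h1 | h1 <;>
      rcases abs_choice (Q.ξ t - Q.ξ u') with h2 | h2
    · exact ⟨0, by omega⟩
    · exact ⟨1, by omega⟩
    · exact ⟨-1, by omega⟩
    · exact ⟨0, by omega⟩
  · omega
  · exact Q.eq_of_orb_eq_of_d_eq_one horb h1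

/-- The contribution of a larger orbit to the mesh relation at a fixed vertex `t`. -/
theorem neighbour_sum_of_lt {t v : V} (h : Q.Δ.Adj t v) (hv : v ∈ Q.tops)
    (ht : Q.d (Q.orb t) = 1) (hd : 1 < Q.d (Q.orb v)) :
    (∑ k ∈ Finset.range (Q.d (Q.orb v)),
      if (Q.perm ^ k) v ∈ Q.tops ∧ Q.ξ t < Q.ξ ((Q.perm ^ k) v) then
        Q.w Q.XTop (fundWeight ((Q.perm ^ k) v)) else fundWeight ((Q.perm ^ k) v)) =
      ∑ k ∈ Finset.range (Q.d (Q.orb v)), Q.topSystem (Q.orb v) (Q.ξ t - 1 - 2 * k) := by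
  have habs := (Q.chain_top h (by omega) hv).1
  have hfund : ∀ k, k < Q.d (Q.orb v) →
      fundWeight ((Q.perm ^ k) v) = Q.topSystem (Q.orb v) (Q.ξ v - 2 * k) := fun k hk => by
    rw [Q.topSystem_top hv, Q.tauTop_pow_fundWeight hv hk]
  by_cases hlt : Q.ξ t < Q.ξ v
  · have heq : Q.ξ v = Q.ξ t + 1 := by rcases abs_choice (Q.ξ t - Q.ξ v) with h1 | h1 <;> omega
    -- the reflection at the top moves its term from the upper to the lower end of the sum
    have hterm := Q.w_XTop_fundWeight_eq_topSystem hv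
    generalize hdv : Q.d (Q.orb v) = d at *
    obtain ⟨m, rfl⟩ := Nat.exists_eq_succ_of_ne_zero (show d ≠ 0 by omega)
    rw [Finset.sum_range_succ', Finset.sum_range_succ]
    congr 1
    · refine Finset.sum_congr rfl fun k hk => ?_
      rw [Finset.mem_range] at hk
      rw [if_neg fun hif => Q.pow_notMem_tops hv (by omega) (by omega) hif.1,
        hfund _ (by omega), heq]
      congr 1
      push_cast
      ring
    · rw [pow_zero, Equiv.Perm.one_apply, if_pos ⟨hv, hlt⟩, hterm, heq]
      congr 1
      push_cast
      ring
  · have heq : Q.ξ v = Q.ξ t - 1 := by rcases abs_choice (Q.ξ t - Q.ξ v) with h1 | h1 <;> omega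
    refine Finset.sum_congr rfl fun k hk => ?_
    rw [if_neg, hfund k (Finset.mem_range.1 hk), heq]
    rintro ⟨-, h2⟩
    have := Q.mem_tops.1 hv _ (Q.orb_perm_pow k v)
    omega

theorem topSystem_mesh_top {t : V} (ht : t ∈ Q.tops) :
    Q.topSystem (Q.orb t) (Q.ξ t) + Q.topSystem (Q.orb t) (Q.ξ t - 2 * Q.d (Q.orb t)) =
      ∑ K : Q.I with Q.orbAdj K (Q.orb t), ∑ k ∈ Finset.range (-Q.c (Q.orb t) K).toNat,
        Q.topSystem K (Q.ξ t - min (Q.d (Q.orb t) : ℤ) (Q.d K) - 2 * k) := by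
  have h0 := Q.topSystem_isNormalizedAt t
  rw [Q.raised_of_mem_tops ht] at h0
  rw [h0, ← Q.w_XTop_fundWeight_eq_topSystem ht, Q.w_XTop_of_mem ht,
    ← Finset.sum_fiberwise_of_maps_to (t := Finset.univ.filter fun K => Q.orbAdj K (Q.orb t))
      (g := Q.orb)]
  swap
  · intro u hu
    exact Finset.mem_filter.2 ⟨Finset.mem_univ _,
      Q.orbAdj_of_adj (Finset.mem_filter.1 hu).2.symm⟩
  refine Finset.sum_congr rfl fun K hK => ?_
  have hKadj := Q.orbAdj_symm (Finset.mem_filter.1 hK).2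
  obtain ⟨v, hv, rfl⟩ := Q.exists_mem_tops K
  rcases Nat.lt_or_ge (Q.d (Q.orb t)) (Q.d (Q.orb v)) with hlt | hge
  · have h1 : Q.d (Q.orb t) = 1 := by
      rcases Q.d_cases_of_orbAdj hKadj with h | h | h <;> omega
    obtain ⟨v', hv', hadj'⟩ := Q.exists_adj_of_orbAdj hKadj
    have hadj : Q.Δ.Adj t v := Q.adj_of_fixed h1 hadj' hv'.symm
    rw [Q.neg_c_toNat_of_d_eq_one hKadj h1, min_eq_left (by exact_mod_cast hlt.le), h1,
      Nat.cast_one, ← Q.neighbour_sum_of_lt hadj hv h1 (by omega)]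
    symm
    refine Finset.sum_bij (fun k _ => (Q.perm ^ k) v) ?_ ?_ ?_ ?_
    · intro k _
      simp only [Finset.mem_filter, Finset.mem_univ, true_and]
      exact ⟨Q.adj_of_fixed h1 hadj (Q.orb_perm_pow k v), Q.orb_perm_pow k v⟩
    · intro j hj k hk hjk
      exact Q.perm_pow_injOn (Finset.mem_range.1 hj) (Finset.mem_range.1 hk) hjk
    · intro u hu
      obtain ⟨k, hk, rfl⟩ := Q.exists_pow_eq (Finset.mem_filter.1 hu).2
      exact ⟨k, Finset.mem_range.2 hk, rfl⟩
    · exact fun k _ => rfl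
  · obtain ⟨u, hu, hadj⟩ := Q.exists_adj_of_orbAdj hKadj
    have hset : (Finset.univ.filter fun x => Q.Δ.Adj t x).filter (fun x => Q.orb x = Q.orb v) =
        {u} := by
      ext x
      simp only [Finset.mem_filter, Finset.mem_univ, true_and, Finset.mem_singleton]
      constructor
      · rintro ⟨hx1, hx2⟩
        exact Q.neighbour_unique hadj hx1 (hx2.trans hu.symm) (hu ▸ hge)
      · rintro rfl
        exact ⟨hadj, hu⟩
    rw [hset, Finset.sum_singleton, Q.neighbour_term_of_le hadj (hu ▸ hge) ht,
      Q.neg_c_toNat_of_le hKadj hge, Finset.sum_range_one, hu,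
      min_eq_right (by exact_mod_cast hge)]
    simp

theorem topSystem_isMeshSystem : Q.IsMeshSystem Q.topSystem Q.tauTop where
  shift := Q.topSystem_shift
  mesh v p hp := by
    have ht := Q.top_mem_tops (Q.orb v)
    have horb := Q.orb_top (Q.orb v)
    refine mesh_of_mesh_at (p := Q.ξ (Q.top (Q.orb v))) Q.topSystem_shift ?_ ?_
    · have := Q.even_sub_of_orb_eq horb
      omega
    · have h := Q.topSystem_mesh_top ht
      rwa [horb] at h

end QDatum

/-! ### Lowering the raised height function to the height function -/

namespace QDatum

variable {V : Type*} [Fintype V] (Q : QDatum V)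

theorem d_eq_of_lt_raised {v w : V} (hv : Q.ξ v < Q.raised v) (h : Q.Δ.Adj v w) :
    Q.d (Q.orb w) = Q.d (Q.orb v) := by
  rcases Q.d_cases h with heq | ⟨h1, h2⟩ | ⟨h1, h2⟩
  · exact heq.symm
  · exact absurd (Q.raised_of_mem_tops (Q.mem_tops_of_d_eq_one h1)) hv.ne'
  · exact absurd (Q.raised_of_adj h.symm (by omega)) hv.ne'

theorem exists_adj_of_lt_raised {v : V} (hv : Q.ξ v < Q.raised v) : ∃ w, Q.Δ.Adj v w :=
  Q.exists_adj_of_d_ne_one fun h =>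
    absurd (Q.raised_of_mem_tops (Q.mem_tops_of_d_eq_one h)) hv.ne'

/-- The set `X'` is the part of the repetition quiver between `ξ` and the raised function. -/
theorem mem_XPrime {x : V × ℤ} :
    x ∈ Q.XPrime ↔ Q.ξ x.1 < x.2 ∧ x.2 ≤ Q.raised x.1 ∧ Q.IsRepVertex x := by
  obtain ⟨v, p⟩ := x
  simp only [XPrime, Finset.mem_biUnion, Finset.mem_filter, Finset.mem_image, Finset.mem_Ioc,
    Prod.mk.injEq]
  constructor
  · rintro ⟨i, -, ⟨q, ⟨h1, h2⟩, rfl, rfl⟩, hrep⟩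
    refine ⟨h1, h2.trans ?_, hrep⟩
    have h3 : Q.perm.symm (Q.σ i) = i := Q.perm.symm_apply_apply i
    rw [raised, h3]
    exact le_max_right _ _
  · rintro ⟨h1, h2, hrep⟩
    have hlt := h1.trans_le h2
    have hmax : Q.raised v = Q.ξ (Q.perm.symm v) - 2 := by
      rw [raised] at hlt ⊢
      omega
    have hσ : Q.σ (Q.perm.symm v) = v := Q.perm.apply_symm_apply v
    refine ⟨Q.perm.symm v, ?_, ⟨p, ⟨by rwa [hσ], by omega⟩, hσ, rfl⟩, hrep⟩
    -- `v` is the image under `σ` of the top of its orbit, since that orbit has two elements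
    obtain ⟨t, ht, horb⟩ := Q.exists_mem_tops (Q.orb v)
    obtain ⟨k, hk, rfl⟩ := Q.exists_pow_eq horb.symm
    have hd : ¬ 2 < Q.d (Q.orb t) := by
      intro hd
      rw [← Q.orb_perm_pow k] at hd
      obtain ⟨u, hu, hu1⟩ := Q.exists_fixed_adj_of_two_lt hd
      exact absurd (Q.raised_of_adj hu (by omega)) hlt.ne'
    rcases k with _ | k
    · exact absurd (Q.raised_of_mem_tops ht) hlt.ne'
    · obtain rfl : k = 0 := by omega
      rw [zero_add, pow_one, Equiv.symm_apply_apply]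
      exact ht

variable {Q} {Ψ : Q.I → ℤ → WeightLattice V} {T : WeightLattice V ≃ₗ[ℤ] WeightLattice V}
  {η : V → ℤ}

/-- At a vertex `v` that lies above all its neighbours, which are assumed to be in orbits of the
same size, the mesh relation computes the next value of the system as `s_v ϖ_v`. -/
theorem IsMeshSystem.apply_sub_of_source (h : Q.IsMeshSystem Ψ T) (hη : Q.IsNormalizedAt Ψ η)
    {v : V} (hv : 2 ∣ η v - Q.ξ v)
    (hd : ∀ w, Q.Δ.Adj v w → Q.d (Q.orb w) = Q.d (Q.orb v))
    (hsource : ∀ w, Q.Δ.Adj v w → η w = η v - Q.d (Q.orb v)) :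
    Ψ (Q.orb v) (η v - 2 * Q.d (Q.orb v)) = simpleReflection Q.Δ v (fundWeight v) := by
  have h1 := h.mesh v (η v) hv
  rw [hη v] at h1
  rw [simpleReflection_fundWeight_self, eq_sub_iff_add_eq', h1]
  symm
  refine Finset.sum_bij (fun u _ => Q.orb u) ?_ ?_ ?_ ?_
  · intro u hu
    exact Finset.mem_filter.2 ⟨Finset.mem_univ _,
      Q.orbAdj_of_adj (Finset.mem_filter.1 hu).2.symm⟩
  · intro u hu u' hu' horb
    have hadj := (Finset.mem_filter.1 hu').2
    exact Q.neighbour_unique hadj (Finset.mem_filter.1 hu).2 horb (hd _ hadj).le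
  · intro K hK
    obtain ⟨w, hw, hadj⟩ := Q.exists_adj_of_orbAdj (Q.orbAdj_symm (Finset.mem_filter.1 hK).2)
    exact ⟨w, Finset.mem_filter.2 ⟨Finset.mem_univ _, hadj⟩, hw⟩
  · intro u hu
    have hadj := (Finset.mem_filter.1 hu).2
    rw [Q.neg_c_toNat_of_le (Q.orbAdj_of_adj hadj) (hd u hadj).le, Finset.sum_range_one,
      hd u hadj, min_self, Nat.cast_zero, mul_zero, sub_zero, ← hsource u hadj, hη u]

/-- Lowering the function `η` at a source `v` amounts to the change of coordinates by `s_v`. -/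
theorem IsMeshSystem.isNormalizedAt_update (h : Q.IsMeshSystem Ψ T) (hη : Q.IsNormalizedAt Ψ η)
    {v : V} (hv : 2 ∣ η v - Q.ξ v)
    (hd : ∀ w, Q.Δ.Adj v w → Q.d (Q.orb w) = Q.d (Q.orb v))
    (hsource : ∀ w, Q.Δ.Adj v w → η w = η v - Q.d (Q.orb v)) :
    Q.IsNormalizedAt (fun J p => simpleReflection Q.Δ v (Ψ J p))
      (Function.update η v (η v - 2 * Q.d (Q.orb v))) := by
  intro u
  beta_reduce
  by_cases huv : u = v
  · subst huv
    rw [Function.update_self, h.apply_sub_of_source hη hv hd hsource, ← LinearEquiv.mul_apply,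
      simpleReflection_mul_self]
    rfl
  · rw [Function.update_of_ne huv, hη u, simpleReflection_fundWeight_of_ne Q.Δ huv]

theorem add_le_of_dvd_sub {a b d : ℤ} (h : d ∣ b - a) (hlt : a < b) : a + d ≤ b := by
  have := Int.le_of_dvd (by omega) h
  omega

/-- An intermediate stage of the passage from the raised height function to `ξ`: a function `η`
between the two with the residues of `ξ` that satisfies the first condition on height functions. -/
structure IsIntermediate (Q : QDatum V) (η : V → ℤ) : Prop where
  le : ∀ v, Q.ξ v ≤ η v
  le_raised : ∀ v, η v ≤ Q.raised v
  dvd : ∀ v, 2 * (Q.d (Q.orb v) : ℤ) ∣ η v - Q.ξ v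
  abs_sub : ∀ v w, Q.Δ.Adj v w → Q.d (Q.orb v) = Q.d (Q.orb w) → |η v - η w| = Q.d (Q.orb v)

/-- Suppose that no arrow from `(v, p)` ends in the region between `ξ` and `η`. Then `p = η v` and
`v` lies above all its neighbours. -/
theorem IsIntermediate.source (hη : IsIntermediate Q η) {v : V} {p : ℤ} (h1 : Q.ξ v < p)
    (h2 : p ≤ η v) (hrep : Q.IsRepVertex (v, p))
    (harrow : ∀ w q, Q.ξ w < q → q ≤ η w → ¬ Q.RepArrow (v, p) (w, q)) :
    p = η v ∧ ∀ w, Q.Δ.Adj v w → η w = η v - Q.d (Q.orb v) := by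
  have hraised : Q.ξ v < Q.raised v := h1.trans_le (h2.trans (hη.le_raised v))
  have hd0 : (0 : ℤ) < Q.d (Q.orb v) := by exact_mod_cast Q.d_pos (Q.orb v)
  have hrep' : 2 * (Q.d (Q.orb v) : ℤ) ∣ p - Q.ξ v := hrep
  have key : ∀ w, Q.Δ.Adj v w → η w < p + Q.d (Q.orb v) := by
    intro w hw
    by_contra! hle
    have hd := Q.d_eq_of_lt_raised hraised hw
    have habs := Q.abs_sub_of_d_eq hw hd.symm
    have h3 := add_le_of_dvd_sub hrep' h1
    refine harrow w (p + Q.d (Q.orb v)) ?_ hle ⟨hrep, ?_, hw, ?_⟩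
    · rcases abs_choice (Q.ξ v - Q.ξ w) with h | h <;> omega
    · change 2 * (Q.d (Q.orb w) : ℤ) ∣ p + Q.d (Q.orb v) - Q.ξ w
      rw [hd]
      obtain ⟨m, hm⟩ := hrep'
      rcases abs_choice (Q.ξ v - Q.ξ w) with h | h
      · exact ⟨m + 1, by linarith⟩
      · exact ⟨m, by linarith⟩
    · change p + (Q.d (Q.orb v) : ℤ) - p = min (Q.d (Q.orb v) : ℤ) (Q.d (Q.orb w))
      rw [hd, min_self]
      ring
  have hp : p = η v := by
    by_contra hne
    obtain ⟨w, hw⟩ := Q.exists_adj_of_lt_raised hraised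
    have h3 := key w hw
    have h4 := hη.abs_sub v w hw (Q.d_eq_of_lt_raised hraised hw).symm
    have h5 : p + 2 * (Q.d (Q.orb v) : ℤ) ≤ η v := by
      refine add_le_of_dvd_sub ?_ (by omega)
      have := dvd_sub (hη.dvd v) hrep'
      rwa [sub_sub_sub_cancel_right] at this
    rcases abs_choice (η v - η w) with h | h <;> omega
  refine ⟨hp, fun w hw => ?_⟩
  have h3 := key w hw
  have h4 := hη.abs_sub v w hw (Q.d_eq_of_lt_raised hraised hw).symm
  rcases abs_choice (η v - η w) with h | h <;> omega

theorem IsIntermediate.update (hη : IsIntermediate Q η) {v : V} (h1 : Q.ξ v < η v)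
    (hsource : ∀ w, Q.Δ.Adj v w → η w = η v - Q.d (Q.orb v)) :
    IsIntermediate Q (Function.update η v (η v - 2 * Q.d (Q.orb v))) where
  le u := by
    by_cases hu : u = v
    · subst hu
      have := add_le_of_dvd_sub (hη.dvd u) h1
      rw [Function.update_self]
      omega
    · rw [Function.update_of_ne hu]
      exact hη.le u
  le_raised u := by
    by_cases hu : u = v
    · subst hu
      have := hη.le_raised u
      rw [Function.update_self]
      omega
    · rw [Function.update_of_ne hu]
      exact hη.le_raised u
  dvd u := by
    by_cases hu : u = v
    · subst hu
      rw [Function.update_self, sub_right_comm]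
      exact dvd_sub (hη.dvd u) dvd_rfl
    · rw [Function.update_of_ne hu]
      exact hη.dvd u
  abs_sub u w huw hd := by
    by_cases hu : u = v
    · subst hu
      have h2 := hsource w huw
      rw [Function.update_self, Function.update_of_ne huw.ne', h2]
      rw [show η u - 2 * (Q.d (Q.orb u) : ℤ) - (η u - Q.d (Q.orb u)) = -(Q.d (Q.orb u) : ℤ) by ring,
        abs_neg, Nat.abs_cast]
    · by_cases hw : w = v
      · subst hw
        have h2 := hsource u huw.symm
        rw [Function.update_self, Function.update_of_ne hu, h2, hd]
        rw [show η w - (Q.d (Q.orb w) : ℤ) - (η w - 2 * Q.d (Q.orb w)) = Q.d (Q.orb w) by ring,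
          Nat.abs_cast]
      · rw [Function.update_of_ne hu, Function.update_of_ne hw]
        exact hη.abs_sub u w huw hd

/-- Reading the region between `ξ` and `η` from above, every vertex is a source of the current
function when it is reached; the corresponding simple reflection lowers the function there. -/
theorem IsMeshSystem.exists_of_reading (L : List (V × ℤ)) (h : Q.IsMeshSystem Ψ T)
    (hnorm : Q.IsNormalizedAt Ψ η) (hη : IsIntermediate Q η) (hnodup : L.Nodup)
    (hmem : ∀ x, x ∈ L ↔ Q.ξ x.1 < x.2 ∧ x.2 ≤ η x.1 ∧ Q.IsRepVertex x)
    (hpair : L.Pairwise fun x y => ¬ Q.RepArrow x y) :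
    ∃ Ψ' : Q.I → ℤ → WeightLattice V, Q.IsMeshSystem Ψ'
      ((L.map fun x => simpleReflection Q.Δ x.1).prod⁻¹ * T *
        (L.map fun x => simpleReflection Q.Δ x.1).prod) ∧ Q.IsNormalizedAt Ψ' Q.ξ := by
  induction L generalizing Ψ T η with
  | nil =>
    have heq : η = Q.ξ := by
      funext v
      by_contra hne
      have := (hmem (v, η v)).2 ⟨lt_of_le_of_ne (hη.le v) (Ne.symm hne), le_rfl, hη.dvd v⟩
      simp at this
    subst heq
    refine ⟨Ψ, ?_, hnorm⟩
    simpa using h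
  | cons x L ih =>
    obtain ⟨v, p⟩ := x
    obtain ⟨h1, h2, hrep⟩ := (hmem (v, p)).1 List.mem_cons_self
    rw [List.nodup_cons] at hnodup
    rw [List.pairwise_cons] at hpair
    dsimp only at h1 h2
    obtain ⟨rfl, hsource⟩ := hη.source h1 h2 hrep fun w q hq1 hq2 harrow => by
      have hin := (hmem (w, q)).2 ⟨hq1, hq2, harrow.2.1⟩
      rcases List.mem_cons.1 hin with heq | hin
      · exact harrow.2.2.1.ne (congrArg Prod.fst heq).symm
      · exact hpair.1 _ hin harrow
    have hraised : Q.ξ v < Q.raised v := h1.trans_le (hη.le_raised v)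
    have hd := fun w hw => Q.d_eq_of_lt_raised (w := w) hraised hw
    have htwo : (2 : ℤ) ∣ η v - Q.ξ v := (Dvd.intro _ rfl).trans (hη.dvd v)
    have hinv : (simpleReflection Q.Δ v)⁻¹ = simpleReflection Q.Δ v :=
      inv_eq_of_mul_eq_one_left (simpleReflection_mul_self Q.Δ v)
    have hmem' : ∀ x, x ∈ L ↔ Q.ξ x.1 < x.2 ∧
        x.2 ≤ Function.update η v (η v - 2 * Q.d (Q.orb v)) x.1 ∧ Q.IsRepVertex x := by
      rintro ⟨u, q⟩
      have hiff : (u, q) ∈ L ↔ (u, q) ∈ (v, η v) :: L ∧ (u, q) ≠ (v, η v) := by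
        rw [List.mem_cons]
        constructor
        · intro hin
          exact ⟨Or.inr hin, fun heq => hnodup.1 (heq ▸ hin)⟩
        · rintro ⟨heq | hin, hne⟩
          · exact absurd heq hne
          · exact hin
      rw [hiff, hmem]
      by_cases hu : u = v
      · subst hu
        simp only [Function.update_self, Ne, Prod.mk.injEq, true_and]
        constructor
        · rintro ⟨⟨h3, h4, h5⟩, hne⟩
          refine ⟨h3, ?_, h5⟩
          have h6 := dvd_sub (hη.dvd u) (show 2 * (Q.d (Q.orb u) : ℤ) ∣ q - Q.ξ u from h5)
          rw [sub_sub_sub_cancel_right] at h6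
          have := add_le_of_dvd_sub h6 (by omega)
          omega
        · rintro ⟨h3, h4, h5⟩
          have := Q.d_pos (Q.orb u)
          exact ⟨⟨h3, by omega, h5⟩, by omega⟩
      · simp only [Function.update_of_ne hu, Ne, Prod.mk.injEq, hu, false_and, not_false_eq_true,
          and_true]
    obtain ⟨Ψ', hΨ', hnorm'⟩ := ih (h.conj (simpleReflection Q.Δ v))
      (h.isNormalizedAt_update hnorm htwo hd hsource) (hη.update h1 hsource) hnodup.2 hmem' hpair.2
    refine ⟨Ψ', ?_, hnorm'⟩
    rw [List.map_cons, List.prod_cons, mul_inv_rev, hinv]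
    rw [hinv] at hΨ'
    simpa only [mul_assoc] using hΨ'

theorem exists_isMeshSystem_tau (Q : QDatum V) :
    ∃ Ψ : Q.I → ℤ → WeightLattice V, Q.IsMeshSystem Ψ Q.tau ∧ Q.IsNormalizedAt Ψ Q.ξ := by
  obtain ⟨hnodup, hmem, hpair⟩ := Q.isCompatibleReading_reading Q.XPrime
  have hη : IsIntermediate Q Q.raised :=
    ⟨fun v => le_max_left _ _, fun v => le_rfl, Q.two_d_dvd_raised,
      fun v w hvw hd => Q.abs_sub_raised hvw hd⟩
  exact Q.topSystem_isMeshSystem.exists_of_reading _ Q.topSystem_isNormalizedAt hη hnodup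
    (fun x => (hmem x).trans Q.mem_XPrime) hpair

end QDatum

/-! ### The additive property -/

theorem mainTheorem2 {V : Type*} [Fintype V] (Q : QDatum V)
    (S : Finset V) (hS : Set.BijOn Q.orb (S : Set V) Set.univ) (i : V) (l : ℤ) :
    (∀ j : V, Q.orbAdj (Q.orb j) (Q.orb i) → Even (Q.shift i j)) ∧
    (Q.tau ^ l) (Q.gamma i) + (Q.tau ^ (l + (Q.d (Q.orb i) : ℤ))) (Q.gamma i) =
      ∑ j ∈ S with Q.orbAdj (Q.orb j) (Q.orb i),
        ∑ t ∈ Finset.range (-Q.c (Q.orb j) (Q.orb i)).toNat,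
          (Q.tau ^ (l + (t : ℤ) + Q.shift i j / 2)) (Q.gamma j) ∧
    weightToRat
        ((Q.tau ^ l) (Q.gamma i) + (Q.tau ^ (l + (Q.d (Q.orb i) : ℤ))) (Q.gamma i)) =
      ∑ J : Q.I with Q.orbAdj J (Q.orb i),
        ∑ t ∈ Finset.range (-Q.c J (Q.orb i)).toNat,
          (1 / (Q.d J : ℚ)) •
            ∑ j ∈ Q.fiber J,
              weightToRat ((Q.tau ^ (l + (t : ℤ) + Q.shift i j / 2)) (Q.gamma j)) := by
  obtain ⟨Ψ, hΨ, hnorm⟩ := Q.exists_isMeshSystem_tau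
  exact ⟨fun j hj => Q.even_shift hj,
    QDatum.additive_property_of_isMeshSystem hΨ hnorm S hS i l,
    QDatum.averaged_additive_property_of_isMeshSystem hΨ hnorm i l⟩
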